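/- For $\tau>0$, $\sigma>1$ put $M_0^{\tau,\sigma}=1$ and $M_p^{\tau,\sigma}=p^{\tau p^\sigma}$ for $p\ge 1$. Let $\mathcal E_{\{\tau,\sigma\}}(\mathbb R)$ (Roumieu type) be the set of all $f\in C^\infty(\mathbb R)$ such that for every compact $K\subset\mathbb R$ there are $C,h>0$ with $|f^{(p)}(x)|\le C h^{p^\sigma}M_p^{\tau,\sigma}$ for all $x\in K$ and all integers $p\ge 0$, and let $\mathcal E_{(\tau,\sigma)}(\mathbb R)$ (Beurling type) be the set of all $f\in C^\infty(\mathbb R)$ such that for every compact $K$ and every $h>0$ there is $C>0$ with the same bound. Write $\mathcal E_{\tau,\sigma}$ for either of these (one fixed type throughout), let $\mathcal D_{\tau,\sigma}(\mathbb R)$ be the set of compactly supported functions in $\mathcal E_{\tau,\sigma}(\mathbb R)$, and $\mathcal D_\sigma(\mathbb R)=\bigcap_{\tau>0}\mathcal D_{\tau,\sigma}(\mathbb R)$. The Fourier transform is $\widehat f(\xi)=\int_{\mathbb R}f(x)e^{ix\xi}\,dx$. A function $\psi\in L^2(\mathbb R)$ is an orthonormal wavelet if the functions $\psi_{m,n}(x)=2^{m/2}\psi(2^mx-n)$,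 $m,n\in\mathbb Z$, form an orthonormal basis of $L^2(\mathbb R)$. **Lemma.** Let $\sigma>1$ and $0<a<\pi/3$. There is a non-negative even function $\phi_a\in\mathcal D_\sigma(\mathbb R)$ with $\operatorname{supp}\phi_a\subset[-a,a]$ and $\int_{\mathbb R}\phi_a\,dx=\pi/2$. For every such $\phi_a$, put $\phi_{2a}(x)=\tfrac12\phi_a(x/2)$, $\theta_c(x)=\int_{-\infty}^x\phi_c(t)\,dt$ for $c\in\{a,2a\}$, and $$b_a(\xi)=\sin\big(\theta_a(|\xi|-\pi)\big)\cos\big(\theta_{2a}(|\xi|-2\pi)\big),\qquad \xi\in\mathbb R.$$ Then there is an orthonormal wavelet $\psi\in C^\infty(\mathbb R)\cap L^1(\mathbb R)$ with $\widehat\psi(\xi)=e^{i\xi/2}b_a(\xi)$ for all $\xi\in\mathbb R$, and $\widehat\psi\in\mathcal D_\sigma(\mathbb R)$. In particular, for every $\sigma>1$ there is an orthonormal wavelet $\psi\in C^\infty(\mathbb R)$ with $\widehat\psi\in\mathcal D_\sigma(\mathbb R)$. -/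

import Mathlib

namespace ExtGevrey

open MeasureTheory
open scoped ContDiff

noncomputable section

/-- The defining sequence `M_p = p ^ (τ p ^ σ)` for `p ≥ 1`, with `M_0 = 1`. -/
def M (τ σ : ℝ) (p : ℕ) : ℝ :=
  if p = 0 then 1 else (p : ℝ) ^ (τ * (p : ℝ) ^ σ)

/-- The two types of extended Gevrey classes, written `{τ, σ}` and `(τ, σ)` respectively. -/
inductive Kind
  | roumieu
  | beurling

/-- Roumieu type class: on every compact set the bound holds for some `h > 0`. -/
def roumieuE (τ σ : ℝ) (F : Type*) [NormedAddCommGroup F] [NormedSpace ℝ F] : Set (ℝ → F) :=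
  {f | ContDiff ℝ ∞ f ∧ ∀ K : Set ℝ, IsCompact K → ∃ C > 0, ∃ h > 0, ∀ x ∈ K, ∀ p : ℕ,
    ‖iteratedDeriv p f x‖ ≤ C * h ^ ((p : ℝ) ^ σ) * M τ σ p}

/-- Beurling type class: on every compact set the bound holds for every `h > 0`. -/
def beurlingE (τ σ : ℝ) (F : Type*) [NormedAddCommGroup F] [NormedSpace ℝ F] : Set (ℝ → F) :=
  {f | ContDiff ℝ ∞ f ∧ ∀ K : Set ℝ, IsCompact K → ∀ h : ℝ, 0 < h → ∃ C > 0, ∀ x ∈ K, ∀ p : ℕ,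
    ‖iteratedDeriv p f x‖ ≤ C * h ^ ((p : ℝ) ^ σ) * M τ σ p}

/-- The extended Gevrey class `E_{τ,σ}(ℝ)`, of either type, of `F`-valued functions. -/
def E (k : Kind) (τ σ : ℝ) (F : Type*) [NormedAddCommGroup F] [NormedSpace ℝ F] : Set (ℝ → F) :=
  match k with
  | Kind.roumieu => roumieuE τ σ F
  | Kind.beurling => beurlingE τ σ F

/-- `D_{τ,σ}(ℝ)`: the compactly supported functions in `E_{τ,σ}(ℝ)`. -/
def D (k : Kind) (τ σ : ℝ) (F : Type*) [NormedAddCommGroup F] [NormedSpace ℝ F] : Set (ℝ → F) :=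
  {f | f ∈ E k τ σ F ∧ HasCompactSupport f}

/-- `D_σ(ℝ)`: the intersection of all `D_{τ,σ}(ℝ)`, `τ > 0`. -/
def DInter (k : Kind) (σ : ℝ) (F : Type*) [NormedAddCommGroup F] [NormedSpace ℝ F] :
    Set (ℝ → F) :=
  ⋂ (τ : ℝ) (_ : 0 < τ), D k τ σ F

/-- The Fourier transform of an integrable function, with kernel `exp (i x ξ)`. -/
def fourierHat (f : ℝ → ℂ) (ξ : ℝ) : ℂ :=
  ∫ x : ℝ, f x * Complex.exp (Complex.I * (x : ℂ) * (ξ : ℂ))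

/-- `ψ_{m,n}(x) = 2 ^ (m/2) ψ(2 ^ m x - n)`. -/
def atom (ψ : ℝ → ℂ) (m n : ℤ) (x : ℝ) : ℂ :=
  (((2 : ℝ) ^ ((m : ℝ) / 2) : ℝ) : ℂ) * ψ ((2 : ℝ) ^ m * x - (n : ℝ))

/-- `ψ ∈ L²(ℝ)` and (the classes of) the `ψ_{m,n}` form an orthonormal basis of `L²(ℝ)`. -/
def IsOrthonormalWavelet (ψ : ℝ → ℂ) : Prop :=
  MemLp ψ 2 (volume : Measure ℝ) ∧
    ∃ b : HilbertBasis (ℤ × ℤ) ℂ (Lp ℂ 2 (volume : Measure ℝ)),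
      ∀ m n : ℤ, ⇑(b (m, n)) =ᵐ[volume] atom ψ m n

/-- Cutoff functions `φ` in `D_σ(ℝ)`: non-negative, even, supported in `[-a, a]`, of integral
`π / 2`. -/
structure IsCutoff (k : Kind) (σ a : ℝ) (φ : ℝ → ℝ) : Prop where
  mem : φ ∈ DInter k σ ℝ
  nonneg : ∀ x, 0 ≤ φ x
  even : ∀ x, φ (-x) = φ x
  supp : tsupport φ ⊆ Set.Icc (-a) a
  integral_eq : ∫ x, φ x = Real.pi / 2

/-- The primitive `θ(x)` of `φ`, the integral of `φ` over `(-∞, x]`. -/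
def primitive (φ : ℝ → ℝ) (x : ℝ) : ℝ :=
  ∫ t in Set.Iic x, φ t

/-- The dilated cutoff: if `φ` is a cutoff for `a`, this is the one used for `2a`. -/
def dilate (φ : ℝ → ℝ) (t : ℝ) : ℝ :=
  φ (t / 2) / 2

/-- The even bell function; for `ξ ≥ 0` it is `S_a (ξ - π) * C_{2a} (ξ - 2π)`, with
`S_a` and `C_{2a}` the sine and cosine of the primitives of `φ` and of its dilate. -/
def bell (φ : ℝ → ℝ) (ξ : ℝ) : ℝ :=
  Real.sin (primitive φ (|ξ| - Real.pi)) *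
    Real.cos (primitive (dilate φ) (|ξ| - 2 * Real.pi))

end

end ExtGevrey

/-!
The proof has three independent parts.

*The class `D_σ`.* Since `M_p = exp (τ p ^ σ log p)` and `τ > 0` is arbitrary, both `D_σ` are the
smooth compactly supported functions all of whose derivatives satisfy, for every `ε > 0`, a bound
`C exp (ε p ^ σ log p)` (`UltraSmooth`): the factors `h ^ (p ^ σ)` are absorbed in `ε`, and so are
`R ^ p` and `p !` because `σ > 1`. The weight is superadditive, so products stay in the class. For
`sin θ` and `cos θ` no composition formula is needed: they solve `S' = C φ`, `C' = -S φ`, and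
induction along this system bounds their derivatives by `R ^ p p ! exp (ε p ^ σ log p)`
(`UltraSmooth.sin_cos`). The function `exp (-1 / x)` has derivatives bounded by `2 ^ p (2 p)!`, so it
belongs to the class, and the product of two of its translates gives the cutoff.

*The wavelet basis.* Write `ξ = 2 π w`, `α w = sin θ(2 π |w| - π)`, `γ w = cos θ(2 π |w| - π)`. Then
the bell is `β w = α w γ (w / 2)`, supported in `1 / 3 ≤ |w| ≤ 4 / 3`, and `α (1 - w) = γ w` on
`[0, 1]` (`ComplementaryPair`). By Parseval on the period `(1 / 3, 4 / 3)`, the squares of the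
coefficients of `F` at scale `2 ^ m` add up to the integral of a folded version of `F (2 ^ m ·)`. On
`(1 / 3, 2 / 3)` and on `(2 / 3, 4 / 3)` the folding is one row of a rotation matrix, which turns the
sum into a difference `T m - T (m + 1)` of an energy `T m` lying between the tails
`∫_{|w| > 2 ^ (m + 1) / 3} |F|²` and `∫_{|w| > 2 ^ m / 3} |F|²`
(`ComplementaryPair.hasSum_norm_sq_inner`). So the coefficients of `F` at any two indices have
squares adding up to at most `‖F‖²`; as the atoms have norm one (`∫ β² = 1`), this makes them
orthonormal. If all coefficients vanish, `T` is constant, and its limits `‖F‖²` and `0` at the two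
ends agree.

*Back to the line.* `ψ` is the inverse Fourier transform of the Schwartz function
`exp (-i π w) β w`, and the unitary Fourier transform of `L²` carries the atoms of `ψ` to those of
the frequency side.
-/

namespace ExtGevrey

open MeasureTheory Filter Topology
open scoped ContDiff Interval FourierTransform SchwartzMap

noncomputable section

/-! ### The weight `p ^ σ log p` -/

/-- The weight `p ^ σ log p`, so that `M_p = exp (τ · growth σ p)`; it is `0` at `p = 0`. -/
def growth (σ : ℝ) (p : ℕ) : ℝ := (p : ℝ) ^ σ * Real.log p

theorem M_eq_exp_growth (τ σ : ℝ) (p : ℕ) : M τ σ p = Real.exp (τ * growth σ p) := by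
  unfold M growth
  split_ifs with hp
  · simp [hp]
  · rw [Real.rpow_def_of_pos (by positivity)]
    ring_nf

theorem growth_nonneg (σ : ℝ) (p : ℕ) : 0 ≤ growth σ p :=
  mul_nonneg (by positivity) (Real.log_natCast_nonneg p)

theorem growth_eq_mul (σ : ℝ) (p : ℕ) :
    growth σ p = p * ((p : ℝ) ^ (σ - 1) * Real.log p) := by
  unfold growth
  rcases Nat.eq_zero_or_pos p with rfl | hp
  · simp
  · have hp' : (0 : ℝ) < p := by exact_mod_cast hp
    rw [Real.rpow_sub_one hp'.ne']
    field_simp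

/-- Superadditivity, because `growth σ p / p` is increasing. -/
theorem growth_add_le {σ : ℝ} (hσ : 1 < σ) (i j : ℕ) :
    growth σ i + growth σ j ≤ growth σ (i + j) := by
  have key : ∀ m n : ℕ, m ≤ n →
      (m : ℝ) ^ (σ - 1) * Real.log m ≤ (n : ℝ) ^ (σ - 1) * Real.log n := by
    intro m n hmn
    rcases Nat.eq_zero_or_pos m with rfl | hm
    · simpa using mul_nonneg (by positivity) (Real.log_natCast_nonneg n)
    have hmn' : (m : ℝ) ≤ n := by exact_mod_cast hmn
    have hm' : (0 : ℝ) < m := by exact_mod_cast hm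
    exact mul_le_mul (Real.rpow_le_rpow hm'.le hmn' (by linarith)) (Real.log_le_log hm' hmn')
      (Real.log_natCast_nonneg m) (by positivity)
  rw [growth_eq_mul σ i, growth_eq_mul σ j, growth_eq_mul σ (i + j)]
  push_cast
  rw [add_mul]
  have h1 := key i (i + j) (by omega)
  have h2 := key j (i + j) (by omega)
  push_cast at h1 h2
  gcongr

theorem growth_mono {σ : ℝ} (hσ : 1 < σ) {i j : ℕ} (h : i ≤ j) : growth σ i ≤ growth σ j := by
  obtain ⟨l, rfl⟩ := Nat.exists_eq_add_of_le h
  linarith [growth_add_le hσ i l, growth_nonneg σ l]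

/-- Any combination of `p`, `p log p` and `p ^ σ` is dominated by an arbitrarily small multiple of
the weight, up to an additive constant. The terms in `p` and `p log p` are where `σ > 1` enters. -/
theorem exists_le_add_growth {σ : ℝ} (hσ : 1 < σ) (A B L : ℝ) {ε : ℝ} (hε : 0 < ε) :
    ∃ C : ℝ, ∀ p : ℕ,
      A * p + B * (p * Real.log p) + L * (p : ℝ) ^ σ ≤ C + ε * growth σ p := by
  have e1 : ∀ᶠ p : ℕ in atTop, |A| + |L| ≤ ε / 2 * Real.log p :=
    ((Real.tendsto_log_atTop.comp tendsto_natCast_atTop_atTop).const_mul_atTop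
      (half_pos hε)).eventually_ge_atTop _
  have e2 : ∀ᶠ p : ℕ in atTop, B ≤ ε / 2 * (p : ℝ) ^ (σ - 1) :=
    (((tendsto_rpow_atTop (by linarith : 0 < σ - 1)).comp
      tendsto_natCast_atTop_atTop).const_mul_atTop (half_pos hε)).eventually_ge_atTop _
  have e3 : ∀ᶠ p : ℕ in atTop,
      A * p + B * (p * Real.log p) + L * (p : ℝ) ^ σ - ε * growth σ p ≤ 0 := by
    filter_upwards [e1, e2, eventually_ge_atTop 1] with p h1 h2 hp
    have hp1 : (1 : ℝ) ≤ p := by exact_mod_cast hp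
    have hps : (p : ℝ) ≤ (p : ℝ) ^ σ := by
      simpa using Real.rpow_le_rpow_of_exponent_le hp1 hσ.le
    have a1 : A * p + L * (p : ℝ) ^ σ ≤ (|A| + |L|) * (p : ℝ) ^ σ := by
      have : A * p ≤ |A| * (p : ℝ) ^ σ :=
        mul_le_mul (le_abs_self A) hps (by positivity) (abs_nonneg A)
      have : L * (p : ℝ) ^ σ ≤ |L| * (p : ℝ) ^ σ := by gcongr; exact le_abs_self L
      linarith
    have a2 : (|A| + |L|) * (p : ℝ) ^ σ ≤ ε / 2 * Real.log p * (p : ℝ) ^ σ := by gcongr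
    have a3 : B * (p * Real.log p) ≤ ε / 2 * (p : ℝ) ^ (σ - 1) * (p * Real.log p) :=
      mul_le_mul_of_nonneg_right h2 (mul_nonneg (by positivity) (Real.log_natCast_nonneg p))
    have a4 := growth_eq_mul σ p
    have a5 : growth σ p = (p : ℝ) ^ σ * Real.log p := rfl
    nlinarith
  obtain ⟨N, hN⟩ := eventually_atTop.1 e3
  obtain ⟨C, hC⟩ := ((Set.finite_lt_nat N).image fun p : ℕ ↦
    A * p + B * (p * Real.log p) + L * (p : ℝ) ^ σ - ε * growth σ p).bddAbove
  refine ⟨max C 0, fun p ↦ ?_⟩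
  rcases lt_or_ge p N with h | h
  · have := hC (Set.mem_image_of_mem _ h)
    have := le_max_left C 0
    beta_reduce at this
    linarith
  · have := hN p h
    have := le_max_right C 0
    linarith

theorem exists_exp_le_exp_growth {σ : ℝ} (hσ : 1 < σ) (A B L : ℝ) {ε : ℝ} (hε : 0 < ε) :
    ∃ C > 0, ∀ p : ℕ, Real.exp (A * p + B * (p * Real.log p) + L * (p : ℝ) ^ σ) ≤
      C * Real.exp (ε * growth σ p) := by
  obtain ⟨C, hC⟩ := exists_le_add_growth hσ A B L hε
  refine ⟨Real.exp C, Real.exp_pos C, fun p ↦ ?_⟩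
  rw [← Real.exp_add]
  exact Real.exp_le_exp.2 (hC p)

theorem factorial_le_exp (p : ℕ) : (p.factorial : ℝ) ≤ Real.exp (p * Real.log p) := by
  rcases Nat.eq_zero_or_pos p with rfl | hp
  · simp
  · rw [mul_comm, Real.exp_mul, Real.exp_log (by exact_mod_cast hp), Real.rpow_natCast]
    exact_mod_cast Nat.factorial_le_pow p

theorem exists_pow_mul_factorial_le {σ : ℝ} (hσ : 1 < σ) {R : ℝ} (hR : 0 < R)
    {ε : ℝ} (hε : 0 < ε) :
    ∃ C > 0, ∀ p : ℕ, R ^ p * p.factorial ≤ C * Real.exp (ε * growth σ p) := by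
  obtain ⟨C, hC, h⟩ := exists_exp_le_exp_growth hσ (Real.log R) 1 0 hε
  refine ⟨C, hC, fun p ↦ le_trans ?_ (h p)⟩
  rw [zero_mul, add_zero, Real.exp_add, Real.exp_mul, Real.exp_log hR, Real.rpow_natCast, one_mul]
  gcongr
  exact factorial_le_exp p

/-! ### The class of ultradifferentiable functions -/

section Class

variable {F : Type*} [NormedAddCommGroup F] [NormedSpace ℝ F]
  {A : Type*} [NormedRing A] [NormedAlgebra ℝ A] {σ : ℝ}

/-- Smooth functions with derivatives `O (exp (ε p ^ σ log p))` for every `ε > 0`, uniformly on the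
whole line. For compactly supported functions this is membership in `D_σ`, of either type. -/
structure UltraSmooth (σ : ℝ) (f : ℝ → F) : Prop where
  contDiff : ContDiff ℝ ∞ f
  bound : ∀ ε > 0, ∃ C, ∀ x p, ‖iteratedDeriv p f x‖ ≤ C * Real.exp (ε * growth σ p)

/-- Factors `R ^ p` and `p !` in the derivative bounds are harmless. -/
theorem UltraSmooth.of_bound (hσ : 1 < σ) {f : ℝ → F} (hf : ContDiff ℝ ∞ f)
    (h : ∀ ε > 0, ∃ C, ∃ R > 0, ∀ x p,
      ‖iteratedDeriv p f x‖ ≤ C * (R ^ p * p.factorial * Real.exp (ε * growth σ p))) :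
    UltraSmooth σ f := by
  refine ⟨hf, fun ε hε ↦ ?_⟩
  obtain ⟨C, R, hR, hC⟩ := h (ε / 2) (half_pos hε)
  obtain ⟨C', hC', h'⟩ := exists_pow_mul_factorial_le hσ hR (half_pos hε)
  have hC0 : 0 ≤ C := by
    have := (norm_nonneg _).trans (hC 0 0)
    simpa [growth] using this
  refine ⟨C * C', fun x p ↦ (hC x p).trans ?_⟩
  have : Real.exp (ε * growth σ p) =
      Real.exp (ε / 2 * growth σ p) * Real.exp (ε / 2 * growth σ p) := by
    rw [← Real.exp_add]; ring_nf
  rw [this, mul_assoc C, ← mul_assoc C']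
  exact mul_le_mul_of_nonneg_left
    (mul_le_mul_of_nonneg_right (h' p) (Real.exp_pos _).le) hC0

theorem norm_iteratedDeriv_mul_le {f g : ℝ → A} (hf : ContDiff ℝ ∞ f) (hg : ContDiff ℝ ∞ g)
    (p : ℕ) (x : ℝ) :
    ‖iteratedDeriv p (fun y ↦ f y * g y) x‖ ≤ ∑ i ∈ Finset.range (p + 1),
      (p.choose i : ℝ) * ‖iteratedDeriv i f x‖ * ‖iteratedDeriv (p - i) g x‖ := by
  simpa only [norm_iteratedFDeriv_eq_norm_iteratedDeriv] using
    norm_iteratedFDeriv_mul_le hf hg x (n := p) (mod_cast le_top)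

theorem UltraSmooth.mul (hσ : 1 < σ) {f g : ℝ → A} (hf : UltraSmooth σ f)
    (hg : UltraSmooth σ g) : UltraSmooth σ fun x ↦ f x * g x := by
  refine .of_bound hσ (hf.contDiff.mul hg.contDiff) fun ε hε ↦ ?_
  obtain ⟨C, hC⟩ := hf.bound ε hε
  obtain ⟨D, hD⟩ := hg.bound ε hε
  refine ⟨C * D, 2, two_pos, fun x p ↦ ?_⟩
  have hC0 : 0 ≤ C := by simpa [growth] using (norm_nonneg _).trans (hC 0 0)
  have hD0 : 0 ≤ D := by simpa [growth] using (norm_nonneg _).trans (hD 0 0)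
  calc _ ≤ _ := norm_iteratedDeriv_mul_le hf.contDiff hg.contDiff p x
    _ ≤ ∑ i ∈ Finset.range (p + 1), (p.choose i : ℝ) *
          (C * D * Real.exp (ε * growth σ p)) := by
      refine Finset.sum_le_sum fun i hi ↦ ?_
      have hip : i + (p - i) = p := by have := Finset.mem_range.1 hi; omega
      rw [mul_assoc]
      refine mul_le_mul_of_nonneg_left ?_ (by positivity)
      calc _ ≤ (C * Real.exp (ε * growth σ i)) * (D * Real.exp (ε * growth σ (p - i))) := by
            gcongr
            · exact hC x i
            · exact hD x (p - i)
        _ = C * D * Real.exp (ε * (growth σ i + growth σ (p - i))) := by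
            rw [mul_add, Real.exp_add]; ring
        _ ≤ _ := by
            have h1 := growth_add_le hσ i (p - i)
            rw [hip] at h1
            gcongr
    _ = C * D * (2 ^ p * 1 * Real.exp (ε * growth σ p)) := by
      rw [← Finset.sum_mul, ← Nat.cast_sum, Nat.sum_range_choose]
      push_cast; ring
    _ ≤ _ := by
      gcongr
      exact_mod_cast Nat.factorial_pos p

theorem UltraSmooth.add {f g : ℝ → F} (hf : UltraSmooth σ f)
    (hg : UltraSmooth σ g) : UltraSmooth σ fun x ↦ f x + g x := by
  refine ⟨hf.contDiff.add hg.contDiff, fun ε hε ↦ ?_⟩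
  obtain ⟨C, hC⟩ := hf.bound ε hε
  obtain ⟨D, hD⟩ := hg.bound ε hε
  refine ⟨C + D, fun x p ↦ ?_⟩
  have h : iteratedDeriv p (fun x ↦ f x + g x) x = iteratedDeriv p f x + iteratedDeriv p g x :=
    iteratedDeriv_add (hf.contDiff.contDiffAt.of_le (mod_cast le_top))
      (hg.contDiff.contDiffAt.of_le (mod_cast le_top))
  rw [h, add_mul]
  exact (norm_add_le _ _).trans (add_le_add (hC x p) (hD x p))

theorem UltraSmooth.comp_affine (hσ : 1 < σ) {f : ℝ → ℝ} (hf : UltraSmooth σ f) (c d : ℝ) :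
    UltraSmooth σ fun x ↦ f (c * x + d) := by
  refine .of_bound hσ (hf.contDiff.comp (by fun_prop)) fun ε hε ↦ ?_
  obtain ⟨C, hC⟩ := hf.bound ε hε
  have hC0 : 0 ≤ C := by simpa [growth] using (norm_nonneg _).trans (hC 0 0)
  refine ⟨C, |c| + 1, by positivity, fun x p ↦ ?_⟩
  have h : iteratedDeriv p (fun x ↦ f (c * x + d)) x = c ^ p * iteratedDeriv p f (c * x + d) := by
    have hs : ContDiff ℝ p fun y ↦ f (y + d) :=
      (hf.contDiff.comp (by fun_prop)).of_le (mod_cast le_top)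
    rw [iteratedDeriv_comp_const_mul (f := fun y ↦ f (y + d)) hs c]
    simp [iteratedDeriv_comp_add_const]
  rw [h, norm_mul, norm_pow, Real.norm_eq_abs]
  calc _ ≤ (|c| + 1) ^ p * (C * Real.exp (ε * growth σ p)) := by
        gcongr
        · linarith
        · exact hC _ p
    _ = C * ((|c| + 1) ^ p * 1 * Real.exp (ε * growth σ p)) := by ring
    _ ≤ _ := by
      gcongr
      exact_mod_cast Nat.factorial_pos p

theorem UltraSmooth.const (c : F) : UltraSmooth σ fun _ : ℝ ↦ c := by
  refine ⟨contDiff_const, fun ε hε ↦ ⟨‖c‖, fun x p ↦ ?_⟩⟩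
  have : 1 ≤ Real.exp (ε * growth σ p) :=
    Real.one_le_exp (mul_nonneg hε.le (growth_nonneg σ p))
  rw [iteratedDeriv_const]
  split_ifs
  · exact le_mul_of_one_le_right (norm_nonneg c) this
  · simp; positivity

theorem UltraSmooth.ofReal {f : ℝ → ℝ} (hf : UltraSmooth σ f) :
    UltraSmooth σ fun x ↦ (f x : ℂ) := by
  refine ⟨Complex.ofRealCLM.contDiff.comp hf.contDiff, fun ε hε ↦ ?_⟩
  obtain ⟨C, hC⟩ := hf.bound ε hε
  refine ⟨C, fun x p ↦ le_trans (le_of_eq ?_) (hC x p)⟩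
  rw [← norm_iteratedFDeriv_eq_norm_iteratedDeriv, ← norm_iteratedFDeriv_eq_norm_iteratedDeriv]
  exact Complex.ofRealLI.norm_iteratedFDeriv_comp_left (hf.contDiff.contDiffAt (x := x))
    (mod_cast le_top)

/-- Sine and cosine of a primitive of `φ` inherit its regularity. Their derivatives are estimated
simultaneously by induction, through `(sin θ)' = cos θ · φ` and `(cos θ)' = -sin θ · φ`. -/
theorem UltraSmooth.sin_cos (hσ : 1 < σ) {φ θ : ℝ → ℝ} (hφ : UltraSmooth σ φ)
    (hθ : ∀ x, HasDerivAt θ (φ x) x) :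
    UltraSmooth σ (fun x ↦ Real.sin (θ x)) ∧ UltraSmooth σ fun x ↦ Real.cos (θ x) := by
  have hθs : ContDiff ℝ ∞ θ := by
    rw [contDiff_infty_iff_deriv]
    refine ⟨fun x ↦ (hθ x).differentiableAt, ?_⟩
    rw [funext fun x ↦ (hθ x).deriv]
    exact hφ.contDiff
  have hS : ContDiff ℝ ∞ fun x ↦ Real.sin (θ x) := Real.contDiff_sin.comp hθs
  have hC : ContDiff ℝ ∞ fun x ↦ Real.cos (θ x) := Real.contDiff_cos.comp hθs
  have dS : deriv (fun x ↦ Real.sin (θ x)) = fun x ↦ Real.cos (θ x) * φ x :=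
    funext fun x ↦ (hθ x).sin.deriv
  have dC : deriv (fun x ↦ Real.cos (θ x)) = fun x ↦ -(Real.sin (θ x) * φ x) :=
    funext fun x ↦ by rw [(hθ x).cos.deriv, neg_mul]
  have key : ∀ ε > 0, ∃ R > 0, ∀ p x,
      ‖iteratedDeriv p (fun x ↦ Real.sin (θ x)) x‖ ≤
        R ^ p * p.factorial * Real.exp (ε * growth σ p) ∧
      ‖iteratedDeriv p (fun x ↦ Real.cos (θ x)) x‖ ≤
        R ^ p * p.factorial * Real.exp (ε * growth σ p) := by
    intro ε hε
    obtain ⟨D, hD⟩ := hφ.bound ε hε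
    refine ⟨max D 1, by positivity, ?_⟩
    set R := max D 1 with hRdef
    have hR : 1 ≤ R := le_max_right _ _
    have step : ∀ (g : ℝ → ℝ) (p : ℕ) (x : ℝ), ContDiff ℝ ∞ g →
        (∀ q ≤ p, ‖iteratedDeriv q g x‖ ≤ R ^ q * q.factorial * Real.exp (ε * growth σ q)) →
        ‖iteratedDeriv p (fun y ↦ g y * φ y) x‖ ≤
          R ^ (p + 1) * (p + 1).factorial * Real.exp (ε * growth σ (p + 1)) := by
      intro g p x hg hb
      calc _ ≤ _ := norm_iteratedDeriv_mul_le hg hφ.contDiff p x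
        _ ≤ ∑ i ∈ Finset.range (p + 1),
            R ^ (p + 1) * p.factorial * Real.exp (ε * growth σ (p + 1)) := by
          refine Finset.sum_le_sum fun i hi ↦ ?_
          have hip : i ≤ p := by have := Finset.mem_range.1 hi; omega
          have hch : (p.choose i : ℝ) * i.factorial ≤ p.factorial := by
            rw [← Nat.choose_mul_factorial_mul_factorial hip]
            exact_mod_cast Nat.le_mul_of_pos_right _ (Nat.factorial_pos _)
          calc _ ≤ (p.choose i : ℝ) * (R ^ i * i.factorial * Real.exp (ε * growth σ i)) *
                (R * Real.exp (ε * growth σ (p - i))) := by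
                gcongr
                · exact hb i hip
                · exact (hD x _).trans (by gcongr; exact le_max_left _ _)
            _ = R ^ (i + 1) * ((p.choose i : ℝ) * i.factorial) *
                Real.exp (ε * (growth σ i + growth σ (p - i))) := by
                rw [mul_add, Real.exp_add]; ring
            _ ≤ _ := by
                have h1 := growth_add_le hσ i (p - i)
                rw [Nat.add_sub_cancel' hip] at h1
                have h2 := growth_mono hσ (Nat.le_succ p)
                have h3 := h1.trans h2
                gcongr
        _ = _ := by
          rw [Finset.sum_const, Finset.card_range, Nat.factorial_succ]
          push_cast
          rw [nsmul_eq_mul]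
          push_cast
          ring
    intro p
    induction p using Nat.strong_induction_on with
    | _ p ih =>
      intro x
      rcases p with _ | p
      · simpa [growth] using ⟨Real.abs_sin_le_one _, Real.abs_cos_le_one _⟩
      · rw [iteratedDeriv_succ', iteratedDeriv_succ', dS, dC]
        refine ⟨step _ p x hC fun q hq ↦ (ih q (by omega) x).2, ?_⟩
        rw [iteratedDeriv_fun_neg, norm_neg]
        exact step _ p x hS fun q hq ↦ (ih q (by omega) x).1
  refine ⟨.of_bound hσ hS fun ε hε ↦ ?_, .of_bound hσ hC fun ε hε ↦ ?_⟩
  · obtain ⟨R, hR, h⟩ := key ε hε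
    exact ⟨1, R, hR, fun x p ↦ by simpa using (h p x).1⟩
  · obtain ⟨R, hR, h⟩ := key ε hε
    exact ⟨1, R, hR, fun x p ↦ by simpa using (h p x).2⟩

theorem UltraSmooth.cexp_I_mul (c : ℝ) (hσ : 1 < σ) :
    UltraSmooth σ fun x : ℝ ↦ Complex.exp (Complex.I * x * c) := by
  have hθ : ∀ x, HasDerivAt (fun x : ℝ ↦ x * c) ((fun _ ↦ c) x) x := fun x ↦ by
    simpa using (hasDerivAt_id x).mul_const c
  obtain ⟨hs, hc⟩ := UltraSmooth.sin_cos hσ (.const c) hθ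
  convert hc.ofReal.add (hs.ofReal.mul hσ (.const Complex.I)) using 2 with x
  push_cast
  rw [← Complex.exp_mul_I]
  ring_nf

/-- For both types: even `h < 1` costs only a factor `exp (|log h| p ^ σ)`. -/
theorem UltraSmooth.mem_DInter (hσ : 1 < σ) {f : ℝ → F} (hf : UltraSmooth σ f)
    (hc : HasCompactSupport f) (k : Kind) : f ∈ DInter k σ F := by
  have hb : ∀ τ > 0, f ∈ beurlingE τ σ F := by
    intro τ hτ
    refine ⟨hf.contDiff, fun K _ h hh ↦ ?_⟩
    obtain ⟨C, hC⟩ := hf.bound (τ / 2) (half_pos hτ)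
    obtain ⟨C', hC', h'⟩ := exists_exp_le_exp_growth hσ 0 0 (-Real.log h) (half_pos hτ)
    have hC0 : 0 ≤ C := by simpa [growth] using (norm_nonneg _).trans (hC 0 0)
    refine ⟨(C + 1) * C', by positivity, fun x _ p ↦ ?_⟩
    have e1 := h' p
    have e2 : Real.exp (-Real.log h * (p : ℝ) ^ σ) * h ^ ((p : ℝ) ^ σ) = 1 := by
      rw [Real.rpow_def_of_pos hh, ← Real.exp_add]; simp
    rw [M_eq_exp_growth]
    simp only [zero_mul, zero_add] at e1
    calc _ ≤ C * Real.exp (τ / 2 * growth σ p) := hC x p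
      _ ≤ (C + 1) * Real.exp (τ / 2 * growth σ p) := by gcongr; linarith
      _ = (C + 1) * (Real.exp (-Real.log h * (p : ℝ) ^ σ) * h ^ ((p : ℝ) ^ σ)) *
          Real.exp (τ / 2 * growth σ p) := by rw [e2, mul_one]
      _ ≤ (C + 1) * ((C' * Real.exp (τ / 2 * growth σ p)) * h ^ ((p : ℝ) ^ σ)) *
          Real.exp (τ / 2 * growth σ p) := by gcongr
      _ = (C + 1) * C' * h ^ ((p : ℝ) ^ σ) *
          (Real.exp (τ / 2 * growth σ p) * Real.exp (τ / 2 * growth σ p)) := by ring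
      _ = _ := by rw [← Real.exp_add]; ring_nf
  refine Set.mem_iInter₂.2 fun τ hτ ↦ ⟨?_, hc⟩
  cases k with
  | beurling => exact hb τ hτ
  | roumieu =>
    refine ⟨hf.contDiff, fun K hK ↦ ?_⟩
    obtain ⟨C, hC, h⟩ := (hb τ hτ).2 K hK 1 one_pos
    exact ⟨C, hC, 1, one_pos, h⟩

theorem UltraSmooth.of_mem_DInter (hσ : 1 < σ) {f : ℝ → F} {k : Kind}
    (hf : f ∈ DInter k σ F) : UltraSmooth σ f := by
  have hD : ∀ τ > 0, f ∈ D k τ σ F := fun τ hτ ↦ Set.mem_iInter₂.1 hf τ hτ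
  have hr : ∀ τ > 0, f ∈ roumieuE τ σ F := by
    intro τ hτ
    have h := (hD τ hτ).1
    cases k with
    | roumieu => exact h
    | beurling =>
      refine ⟨h.1, fun K hK ↦ ?_⟩
      obtain ⟨C, hC, h'⟩ := h.2 K hK 1 one_pos
      exact ⟨C, hC, 1, one_pos, h'⟩
  refine ⟨(hr 1 one_pos).1, fun ε hε ↦ ?_⟩
  obtain ⟨C, hC, h, hh, hb⟩ := (hr (ε / 2) (half_pos hε)).2 (tsupport f) (hD 1 one_pos).2
  obtain ⟨C', hC', h'⟩ := exists_exp_le_exp_growth hσ 0 0 (Real.log h) (half_pos hε)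
  refine ⟨C * C', fun x p ↦ ?_⟩
  by_cases hx : x ∈ tsupport f
  · refine (hb x hx p).trans ?_
    have e1 := h' p
    simp only [zero_mul, zero_add] at e1
    rw [← Real.rpow_def_of_pos hh] at e1
    rw [M_eq_exp_growth]
    calc _ ≤ C * (C' * Real.exp (ε / 2 * growth σ p)) * Real.exp (ε / 2 * growth σ p) := by gcongr
      _ = C * C' * (Real.exp (ε / 2 * growth σ p) * Real.exp (ε / 2 * growth σ p)) := by ring
      _ = _ := by rw [← Real.exp_add]; ring_nf
  · have h0 : iteratedDeriv p f x = 0 := by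
      have := Filter.EventuallyEq.iteratedDeriv_eq p (notMem_tsupport_iff_eventuallyEq.1 hx)
      rw [this]
      simp [Pi.zero_def]
    rw [h0, norm_zero]
    positivity

end Class

/-! ### Existence of the cutoff -/

theorem inv_pow_mul_expNegInvGlue_le (k : ℕ) (x : ℝ) :
    ‖(x⁻¹) ^ k * expNegInvGlue x‖ ≤ k.factorial := by
  rcases le_or_gt x 0 with hx | hx
  · simp [expNegInvGlue.zero_of_nonpos hx]
  · have h := Real.pow_div_factorial_le_exp x⁻¹ (inv_nonneg.2 hx.le) k
    rw [div_le_iff₀ (by positivity)] at h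
    rw [expNegInvGlue, if_neg hx.not_ge, Real.norm_of_nonneg (by positivity), Real.exp_neg,
      ← div_eq_mul_inv, div_le_iff₀ (Real.exp_pos _)]
    linarith

/-- With `g_k x = x⁻ᵏ exp (-1 / x)`, induction on `n` from `g_k' = g_{k+2} - k g_{k+1}`. -/
theorem norm_iteratedDeriv_inv_pow_mul_expNegInvGlue_le (n k : ℕ) (x : ℝ) :
    ‖iteratedDeriv n (fun x ↦ (x⁻¹) ^ k * expNegInvGlue x) x‖ ≤
      2 ^ n * ((k + 2 * n).factorial : ℝ) := by
  have hs : ∀ k : ℕ, ContDiff ℝ ∞ fun x : ℝ ↦ (x⁻¹) ^ k * expNegInvGlue x := fun k ↦ by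
    simpa using! expNegInvGlue.contDiff_polynomial_eval_inv_mul (n := ⊤) (Polynomial.X ^ k)
  induction n generalizing k with
  | zero => simpa using inv_pow_mul_expNegInvGlue_le k x
  | succ n ih =>
    have hd : deriv (fun x : ℝ ↦ (x⁻¹) ^ k * expNegInvGlue x) = fun x ↦
        (x⁻¹) ^ (k + 2) * expNegInvGlue x - k * ((x⁻¹) ^ (k + 1) * expNegInvGlue x) := by
      funext x
      have h := (expNegInvGlue.hasDerivAt_polynomial_eval_inv_mul (Polynomial.X ^ k) x).deriv
      simp only [Polynomial.eval_pow, Polynomial.eval_X] at h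
      rw [h]
      rcases k with _ | k
      · simp
      · simp
        ring
    rw [iteratedDeriv_succ', hd]
    have e : iteratedDeriv n (fun x : ℝ ↦ (x⁻¹) ^ (k + 2) * expNegInvGlue x -
        k * ((x⁻¹) ^ (k + 1) * expNegInvGlue x)) x =
        iteratedDeriv n (fun x : ℝ ↦ (x⁻¹) ^ (k + 2) * expNegInvGlue x) x -
        k * iteratedDeriv n (fun x : ℝ ↦ (x⁻¹) ^ (k + 1) * expNegInvGlue x) x := by
      rw [← iteratedDeriv_const_mul_field]
      exact iteratedDeriv_sub ((hs _).contDiffAt.of_le (mod_cast le_top))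
        ((contDiff_const.mul (hs _)).contDiffAt.of_le (mod_cast le_top))
    have hk : (k : ℝ) * ((k + 1 + 2 * n).factorial : ℝ) ≤ ((k + 2 + 2 * n).factorial : ℝ) := by
      rw [show k + 2 + 2 * n = (k + 1 + 2 * n) + 1 by ring, Nat.factorial_succ]
      exact_mod_cast Nat.mul_le_mul_right _ (by omega)
    rw [e]
    calc _ ≤ 2 ^ n * ((k + 2 + 2 * n).factorial : ℝ) +
          k * (2 ^ n * ((k + 1 + 2 * n).factorial : ℝ)) := by
          refine (norm_sub_le _ _).trans ?_
          rw [norm_mul, Real.norm_natCast]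
          gcongr
          · exact ih (k + 2)
          · exact ih (k + 1)
      _ = 2 ^ n * (((k + 2 + 2 * n).factorial : ℝ) +
          k * ((k + 1 + 2 * n).factorial : ℝ)) := by ring
      _ ≤ 2 ^ n * (((k + 2 + 2 * n).factorial : ℝ) + ((k + 2 + 2 * n).factorial : ℝ)) := by gcongr
      _ = _ := by rw [show k + 2 * (n + 1) = k + 2 + 2 * n by ring]; ring

theorem ultraSmooth_expNegInvGlue {σ : ℝ} (hσ : 1 < σ) : UltraSmooth σ expNegInvGlue := by
  refine .of_bound hσ expNegInvGlue.contDiff fun ε hε ↦ ?_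
  obtain ⟨C, hC, h⟩ := exists_pow_mul_factorial_le hσ one_pos hε
  -- `2 ^ p (2 p)! ≤ 8 ^ p (p !)²`, and one factor `p !` is absorbed in `exp (ε p ^ σ log p)`.
  refine ⟨C, 8, by norm_num, fun x p ↦ ?_⟩
  have h1 := norm_iteratedDeriv_inv_pow_mul_expNegInvGlue_le p 0 x
  simp only [pow_zero, one_mul, zero_add] at h1
  have h2 : ((2 * p).factorial : ℝ) ≤ 4 ^ p * p.factorial * p.factorial := by
    have e := Nat.choose_mul_factorial_mul_factorial (show p ≤ 2 * p by omega)
    rw [show 2 * p - p = p by omega] at e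
    have c : (2 * p).choose p ≤ 4 ^ p := by
      rw [show 4 ^ p = 2 ^ (2 * p) by rw [pow_mul]; norm_num]
      exact Nat.choose_le_two_pow _ _
    rw [← e]
    exact_mod_cast Nat.mul_le_mul_right _ (Nat.mul_le_mul_right _ c)
  have h3 := h p
  rw [one_pow, one_mul] at h3
  calc _ ≤ _ := h1
    _ ≤ 2 ^ p * (4 ^ p * p.factorial * (C * Real.exp (ε * growth σ p))) := by
      refine mul_le_mul_of_nonneg_left (h2.trans ?_) (by positivity)
      gcongr
    _ = _ := by
      rw [show (8 : ℝ) = 2 * 4 by norm_num, mul_pow]; ring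

theorem exists_isCutoff (k : Kind) {σ a : ℝ} (hσ : 1 < σ) (ha : 0 < a) :
    ∃ φ, IsCutoff k σ a φ := by
  set f : ℝ → ℝ := fun x ↦ expNegInvGlue (-1 * x + a) * expNegInvGlue (1 * x + a) with hf
  have hfs : UltraSmooth σ f :=
    ((ultraSmooth_expNegInvGlue hσ).comp_affine hσ _ _).mul hσ
      ((ultraSmooth_expNegInvGlue hσ).comp_affine hσ _ _)
  have hf0 : ∀ x, 0 ≤ f x := fun x ↦
    mul_nonneg (expNegInvGlue.nonneg _) (expNegInvGlue.nonneg _)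
  have hsupp : Function.support f ⊆ Set.Icc (-a) a := by
    intro x hx
    by_contra hx'
    apply hx
    rcases not_and_or.1 hx' with h | h
    · exact mul_eq_zero_of_right _ (expNegInvGlue.zero_of_nonpos (by linarith))
    · exact mul_eq_zero_of_left (expNegInvGlue.zero_of_nonpos (by linarith)) _
  have hts : tsupport f ⊆ Set.Icc (-a) a := closure_minimal hsupp isClosed_Icc
  have hcs : HasCompactSupport f := isCompact_Icc.of_isClosed_subset (isClosed_tsupport f) hts
  have hint : 0 < ∫ x, f x := by
    refine hfs.contDiff.continuous.integral_pos_of_hasCompactSupport_nonneg_nonzero hcs hf0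
      (x := 0) ?_
    simp [hf, ha.not_ge]
  set c := Real.pi / 2 / ∫ x, f x with hc
  have hc0 : 0 ≤ c := by positivity
  have hsub : tsupport (fun x ↦ c * f x) ⊆ tsupport f := closure_mono fun x hx ↦ by
    simp only [Function.mem_support] at hx ⊢
    exact right_ne_zero_of_mul hx
  refine ⟨fun x ↦ c * f x, ?_, fun x ↦ mul_nonneg hc0 (hf0 x), fun x ↦ ?_, hsub.trans hts, ?_⟩
  · exact ((UltraSmooth.const c).mul hσ hfs).mem_DInter hσ
      (hcs.of_isClosed_subset (isClosed_tsupport _) hsub) k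
  · simp only [hf]
    ring_nf
  · rw [integral_const_mul, hc, div_mul_cancel₀ _ hint.ne']

/-! ### Primitive of the cutoff and regularity of the bell -/

section Primitive

variable {k : Kind} {σ a : ℝ} {φ : ℝ → ℝ}

theorem IsCutoff.ultraSmooth (hσ : 1 < σ) (h : IsCutoff k σ a φ) : UltraSmooth σ φ :=
  .of_mem_DInter hσ h.mem

theorem IsCutoff.integrable (hσ : 1 < σ) (h : IsCutoff k σ a φ) : Integrable φ :=
  (h.ultraSmooth hσ).contDiff.continuous.integrable_of_hasCompactSupport
    (isCompact_Icc.of_isClosed_subset (isClosed_tsupport φ) h.supp)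

theorem IsCutoff.hasDerivAt_primitive (hσ : 1 < σ) (h : IsCutoff k σ a φ) (x : ℝ) :
    HasDerivAt (primitive φ) (φ x) x := by
  have hi := h.integrable hσ
  have hc := (h.ultraSmooth hσ).contDiff.continuous
  have e : primitive φ = fun y ↦ (∫ t in (0 : ℝ)..y, φ t) + primitive φ 0 := by
    funext y
    rw [← intervalIntegral.integral_Iic_sub_Iic hi.integrableOn hi.integrableOn]
    simp [primitive]
  rw [e]
  exact (hc.integral_hasStrictDerivAt 0 x).hasDerivAt.add_const _

theorem IsCutoff.primitive_eq_zero (h : IsCutoff k σ a φ) {x : ℝ} (hx : x ≤ -a) :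
    primitive φ x = 0 := by
  rw [primitive, integral_Iic_eq_integral_Iio]
  refine setIntegral_eq_zero_of_forall_eq_zero fun t ht ↦ ?_
  by_contra h0
  have h1 := (h.supp (subset_tsupport φ h0)).1
  have h2 : t < x := ht
  linarith

theorem IsCutoff.primitive_add_primitive_neg (hσ : 1 < σ) (h : IsCutoff k σ a φ) (x : ℝ) :
    primitive φ x + primitive φ (-x) = Real.pi / 2 := by
  have hi := h.integrable hσ
  have e : primitive φ (-x) = ∫ t in Set.Ioi x, φ t := by
    rw [primitive, ← neg_neg x, ← integral_comp_neg_Iic, neg_neg]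
    simp [h.even]
  rw [e, primitive, intervalIntegral.integral_Iic_add_Ioi hi.integrableOn hi.integrableOn,
    h.integral_eq]

theorem IsCutoff.primitive_eq_pi_div_two (hσ : 1 < σ) (h : IsCutoff k σ a φ) {x : ℝ}
    (hx : a ≤ x) : primitive φ x = Real.pi / 2 := by
  have := h.primitive_add_primitive_neg hσ x
  rw [h.primitive_eq_zero (neg_le_neg hx)] at this
  linarith

/-- The primitives satisfy `θ_{2a}(x) = θ_a(x / 2)`. -/
theorem primitive_dilate (φ : ℝ → ℝ) (x : ℝ) :
    primitive (dilate φ) x = primitive φ (x / 2) := by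
  have h1 := integral_comp_neg_Ioi (-x) (dilate φ)
  have h2 := integral_comp_neg_Ioi (-x / 2) φ
  have h3 := integral_comp_mul_left_Ioi (fun t ↦ φ (-t)) (-x) (b := 1 / 2) (by norm_num)
  rw [neg_neg] at h1
  rw [show -(-x / 2) = x / 2 by ring] at h2
  rw [show 1 / 2 * -x = -x / 2 by ring, h2] at h3
  rw [primitive, primitive, ← h1]
  simp only [dilate]
  rw [integral_div, div_eq_iff two_ne_zero]
  convert h3 using 1
  · congr 1 with t; ring_nf
  · norm_num [mul_comm]

theorem bell_eq (φ : ℝ → ℝ) (ξ : ℝ) : bell φ ξ =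
    Real.sin (primitive φ (|ξ| - Real.pi)) * Real.cos (primitive φ (|ξ| / 2 - Real.pi)) := by
  rw [bell, primitive_dilate]
  ring_nf

/-- The bell is `B ξ + B (-ξ)`, where `B` is given by its formula without absolute values: that
formula vanishes on the negative half-line. -/
theorem IsCutoff.ultraSmooth_bell (hσ : 1 < σ) (ha' : a < Real.pi) (h : IsCutoff k σ a φ) :
    UltraSmooth σ (bell φ) := by
  obtain ⟨hs, hc⟩ := UltraSmooth.sin_cos hσ (h.ultraSmooth hσ) (h.hasDerivAt_primitive hσ)
  have hB := ((hs.comp_affine hσ 1 (-Real.pi)).mul hσ (hc.comp_affine hσ (1 / 2) (-Real.pi)))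
  refine (congrArg (UltraSmooth σ) (funext fun ξ ↦ ?_)).mpr (hB.add (hB.comp_affine hσ (-1) 0))
  rw [bell_eq]
  have key : ∀ t, 0 ≤ t → primitive φ (1 * -t + -Real.pi) = 0 := fun t ht ↦
    h.primitive_eq_zero (by linarith)
  rcases le_total 0 ξ with hξ | hξ
  · rw [abs_of_nonneg hξ, show -1 * ξ + 0 = -ξ by ring, key ξ hξ]
    simp
    ring_nf
  · have := key (-ξ) (by linarith)
    rw [neg_neg] at this
    rw [abs_of_nonpos hξ, this]
    simp
    ring_nf

theorem IsCutoff.bell_eq_zero (hσ : 1 < σ) (h : IsCutoff k σ a φ) {ξ : ℝ}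
    (hξ : 2 * (Real.pi + a) ≤ |ξ|) : bell φ ξ = 0 := by
  rw [bell_eq, h.primitive_eq_pi_div_two hσ (x := |ξ| / 2 - Real.pi) (by linarith),
    Real.cos_pi_div_two, mul_zero]

end Primitive

/-! ### Complementary pairs and the Parseval identity at one scale -/

/-- The sine and cosine of the primitive of a cutoff, in the frequency variable `v = ξ / 2π`: a pair
of even functions with `α² + γ² = 1`, going from `(0, 1)` to `(1, 0)` between `|v| = 1 / 3` and
`|v| = 2 / 3`, and exchanged by the reflection `v ↦ 1 - v`. -/
structure ComplementaryPair (α γ : ℝ → ℝ) : Prop where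
  continuous_left : Continuous α
  continuous_right : Continuous γ
  sq_add_sq : ∀ v, α v ^ 2 + γ v ^ 2 = 1
  left_eq_zero : ∀ v, |v| ≤ 1 / 3 → α v = 0
  right_eq_one : ∀ v, |v| ≤ 1 / 3 → γ v = 1
  left_eq_one : ∀ v, 2 / 3 ≤ |v| → α v = 1
  right_eq_zero : ∀ v, 2 / 3 ≤ |v| → γ v = 0
  left_neg : ∀ v, α (-v) = α v
  right_neg : ∀ v, γ (-v) = γ v
  left_one_sub : ∀ v, 0 ≤ v → v ≤ 1 → α (1 - v) = γ v

/-- The bell function of a complementary pair; it lives on `1 / 3 ≤ |v| ≤ 4 / 3`. -/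
def band (α γ : ℝ → ℝ) (v : ℝ) : ℝ := α v * γ (v / 2)

namespace ComplementaryPair

variable {α γ : ℝ → ℝ} (h : ComplementaryPair α γ)
include h

theorem abs_left_le (v : ℝ) : |α v| ≤ 1 :=
  abs_le_one_iff_mul_self_le_one.2 (by nlinarith [h.sq_add_sq v, sq_nonneg (γ v)])

theorem abs_right_le (v : ℝ) : |γ v| ≤ 1 :=
  abs_le_one_iff_mul_self_le_one.2 (by nlinarith [h.sq_add_sq v, sq_nonneg (α v)])

theorem continuous_band : Continuous (band α γ) :=
  h.continuous_left.mul (h.continuous_right.comp (by fun_prop))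

theorem abs_band_le (v : ℝ) : |band α γ v| ≤ 1 := by
  rw [band, abs_mul]
  exact mul_le_one₀ (h.abs_left_le _) (abs_nonneg _) (h.abs_right_le _)

theorem band_eq_zero_of_le {v : ℝ} (hv : |v| ≤ 1 / 3) : band α γ v = 0 := by
  rw [band, h.left_eq_zero v hv, zero_mul]

theorem band_eq_zero_of_ge {v : ℝ} (hv : 4 / 3 ≤ |v|) : band α γ v = 0 := by
  rw [band, h.right_eq_zero (v / 2) (by rw [abs_div, abs_two]; linarith), mul_zero]

theorem band_inner {v : ℝ} (h1 : 1 / 3 ≤ v) (h2 : v ≤ 2 / 3) :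
    band α γ v = α v ∧ band α γ (v - 1) = γ v ∧ band α γ (v - 2) = 0 := by
  refine ⟨?_, ?_, h.band_eq_zero_of_ge ?_⟩
  · rw [band, h.right_eq_one (v / 2) (abs_le.2 ⟨by linarith, by linarith⟩), mul_one]
  · rw [band, h.right_eq_one ((v - 1) / 2) (abs_le.2 ⟨by linarith, by linarith⟩), mul_one,
      ← h.left_neg, neg_sub, h.left_one_sub v (by linarith) (by linarith)]
  · rw [abs_of_nonpos (by linarith)]; linarith

theorem band_outer {v : ℝ} (h1 : 2 / 3 ≤ v) (h2 : v ≤ 4 / 3) :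
    band α γ v = γ (v / 2) ∧ band α γ (v - 1) = 0 ∧ band α γ (v - 2) = α (v / 2) := by
  refine ⟨?_, h.band_eq_zero_of_le (abs_le.2 ⟨by linarith, by linarith⟩), ?_⟩
  · rw [band, h.left_eq_one v (by rwa [abs_of_nonneg (by linarith)]), one_mul]
  · rw [band, h.left_eq_one (v - 2) (by rw [abs_of_nonpos (by linarith)]; linarith), one_mul,
      ← h.right_neg, show -((v - 2) / 2) = 1 - v / 2 by ring,
      ← h.left_one_sub _ (by linarith) (by linarith), sub_sub_cancel]

theorem hasCompactSupport_band : HasCompactSupport (band α γ) :=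
  .intro (K := Set.Icc (-(4 / 3)) (4 / 3)) isCompact_Icc fun v hv ↦ h.band_eq_zero_of_ge <| by
    by_contra! h'
    exact hv (abs_le.1 h'.le)

theorem memLp_band_mul {f : ℝ → ℂ} (hf : Continuous f) :
    MemLp (fun v ↦ band α γ v * f v) 2 volume := by
  have hc : Continuous fun v ↦ (band α γ v : ℂ) * f v :=
    (Complex.continuous_ofReal.comp h.continuous_band).mul hf
  exact hc.memLp_of_hasCompactSupport
    ((h.hasCompactSupport_band.comp_left (g := ((↑) : ℝ → ℂ)) Complex.ofReal_zero).mul_right)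

end ComplementaryPair

section MemLp

variable {H : ℝ → ℂ} (hH : MemLp H 2 volume)
include hH

theorem memLp_ofReal_mul {f : ℝ → ℝ} (hf : Continuous f) (hb : ∀ v, |f v| ≤ 1) :
    MemLp (fun v ↦ (f v : ℂ) * H v) 2 volume := by
  refine hH.of_le_mul (c := 1) (.mul (by fun_prop) hH.1) (.of_forall fun v ↦ ?_)
  rw [norm_mul, Complex.norm_real]
  exact mul_le_mul_of_nonneg_right (hb v) (norm_nonneg _)

theorem memLp_comp_sub (t : ℝ) : MemLp (fun v ↦ H (v - t)) 2 volume :=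
  hH.comp_measurePreserving (measurePreserving_sub_right volume t)

theorem memLp_comp_mul {c : ℝ} (hc : c ≠ 0) : MemLp (fun v ↦ H (c * v)) 2 volume := by
  refine MemLp.comp_of_map (g := H) ?_ (by fun_prop)
  rw [Real.map_volume_mul_left hc]
  exact hH.smul_measure ENNReal.ofReal_ne_top

theorem integrable_norm_sq : Integrable (fun v ↦ ‖H v‖ ^ 2) volume :=
  (memLp_two_iff_integrable_sq_norm hH.1).1 hH

end MemLp

/-- Integral of the periodization: a function supported in `[-4 / 3, 4 / 3]` meets the period
`(1 / 3, 4 / 3)` only through its translates by `0`, `1` and `2`. -/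
theorem integral_eq_periodized {E : Type*} [NormedAddCommGroup E] [NormedSpace ℝ E] {g : ℝ → E}
    (hg : Integrable g) (h0 : ∀ v, 4 / 3 ≤ |v| → g v = 0) :
    ∫ v, g v = ∫ v in (1 / 3 : ℝ)..(4 / 3), (g v + g (v - 1) + g (v - 2)) := by
  have hi : ∀ a b : ℝ, IntervalIntegrable g volume a b := fun a b ↦ hg.intervalIntegrable
  have hs : ∀ t a b : ℝ, IntervalIntegrable (fun v ↦ g (v - t)) volume a b := fun t a b ↦
    (hg.comp_sub_right t).intervalIntegrable
  rw [intervalIntegral.integral_add ((hi _ _).add (hs 1 _ _)) (hs 2 _ _),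
    intervalIntegral.integral_add (hi _ _) (hs 1 _ _),
    intervalIntegral.integral_comp_sub_right, intervalIntegral.integral_comp_sub_right,
    ← intervalIntegral.integral_eq_integral_of_support_subset (a := -5 / 3) (b := 4 / 3)]
  · rw [show (4 / 3 : ℝ) - 1 = 1 / 3 by norm_num, show (4 / 3 : ℝ) - 2 = 1 / 3 - 1 by norm_num,
      show (1 / 3 : ℝ) - 2 = -5 / 3 by norm_num,
      ← intervalIntegral.integral_add_adjacent_intervals (hi (-5 / 3) (1 / 3 - 1)) (hi _ (4 / 3)),
      ← intervalIntegral.integral_add_adjacent_intervals (hi (1 / 3 - 1) (1 / 3)) (hi _ (4 / 3))]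
    abel
  · intro v hv
    have : ¬ 4 / 3 ≤ |v| := fun h ↦ hv (h0 v h)
    have := abs_lt.1 (not_le.1 this)
    exact ⟨by linarith, by linarith⟩

variable {α γ : ℝ → ℝ}

/-- The function `band · H` periodized onto `(1 / 3, 4 / 3)`, with the signs coming from the factor
`exp (iπv)`, which is antiperiodic with antiperiod `1`. -/
def folded (α γ : ℝ → ℝ) (H : ℝ → ℂ) (v : ℝ) : ℂ :=
  band α γ v * H v - band α γ (v - 1) * H (v - 1) + band α γ (v - 2) * H (v - 2)

/-- Parseval's identity for the Fourier series of the periodization of `exp (iπv) band v H v`. -/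
theorem hasSum_norm_sq_integral_band (h : ComplementaryPair α γ) {H : ℝ → ℂ}
    (hH : MemLp H 2 volume) :
    HasSum (fun n : ℤ ↦ ‖∫ v, band α γ v * H v *
        Complex.exp (Complex.I * Real.pi * (2 * n + 1) * v)‖ ^ 2)
      (∫ v in (1 / 3 : ℝ)..(4 / 3), ‖folded α γ H v‖ ^ 2) := by
  have hβH := memLp_ofReal_mul hH h.continuous_band h.abs_band_le
  have hfold : MemLp (folded α γ H) 2 volume :=
    (hβH.sub (memLp_comp_sub hβH 1)).add (memLp_comp_sub hβH 2)
  set u : ℝ → ℂ := fun v ↦ Complex.exp (Complex.I * Real.pi * v) with hu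
  have hun : ∀ v, ‖u v‖ = 1 := fun v ↦ by
    rw [hu]; simp only
    rw [show Complex.I * Real.pi * v = ((Real.pi * v : ℝ) : ℂ) * Complex.I by push_cast; ring]
    exact Complex.norm_exp_ofReal_mul_I _
  have huc : Continuous u := by fun_prop
  set G : ℝ → ℂ := fun v ↦ u v * folded α γ H v with hG
  have hGm : MemLp G 2 (volume.restrict (Set.Ioc (1 / 3) (4 / 3))) := by
    refine MemLp.restrict _ (hfold.of_le_mul (c := 1) (huc.aestronglyMeasurable.mul hfold.1)
      (.of_forall fun v ↦ ?_))
    rw [hG, norm_mul, hun]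
  have hP := hasSum_sq_fourierCoeffOn (by norm_num : (1 / 3 : ℝ) < 4 / 3) hGm
  rw [← (Equiv.neg ℤ).hasSum_iff] at hP
  convert hP using 1
  · funext n
    simp only [Function.comp_apply, Equiv.neg_apply]
    rw [fourierCoeffOn_eq_integral]
    congr 2
    rw [show (1 : ℝ) / (4 / 3 - 1 / 3) = 1 by norm_num, one_smul]
    rw [integral_eq_periodized]
    · refine intervalIntegral.integral_congr fun v _ ↦ ?_
      simp only [fourier_coe_apply, smul_eq_mul, hG, hu, folded, neg_neg]
      -- The character `exp (iπ(2n+1)v)` changes sign under `v ↦ v - 1`.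
      have e0 : Complex.exp (Complex.I * Real.pi * (2 * n + 1) * v) =
          Complex.exp (2 * Real.pi * Complex.I * n * v / ((4 / 3 - 1 / 3 : ℝ) : ℂ)) *
          Complex.exp (Complex.I * Real.pi * v) := by
        rw [← Complex.exp_add]
        congr 1
        push_cast
        ring
      have e1 : Complex.exp (Complex.I * Real.pi * (2 * n + 1) * ((v - 1 : ℝ) : ℂ)) =
          -Complex.exp (Complex.I * Real.pi * (2 * n + 1) * v) := by
        rw [← mul_neg_one, ← Complex.exp_pi_mul_I, ← Complex.exp_add,
          Complex.exp_eq_exp_iff_exists_int]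
        refine ⟨-n - 1, ?_⟩
        push_cast
        ring
      have e2 : Complex.exp (Complex.I * Real.pi * (2 * n + 1) * ((v - 2 : ℝ) : ℂ)) =
          Complex.exp (Complex.I * Real.pi * (2 * n + 1) * v) := by
        rw [Complex.exp_eq_exp_iff_exists_int]
        refine ⟨-2 * n - 1, ?_⟩
        push_cast
        ring
      rw [e1, e2, e0]
      ring
    · refine (hH.integrable_mul (q := 2) (h.memLp_band_mul (f := fun v ↦
        Complex.exp (Complex.I * Real.pi * (2 * n + 1) * v)) (by fun_prop))).congr
        (.of_forall fun v ↦ ?_)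
      simp only [Pi.mul_apply]
      ring
    · intro v hv
      simp [h.band_eq_zero_of_ge hv]
  · rw [show ((4 : ℝ) / 3 - 1 / 3)⁻¹ = 1 by norm_num, one_smul]
    simp only [hG, norm_mul, hun, one_mul]

/-! ### Energies and telescoping over the scales -/

/-- The energy of `H` outside `[-r, r]`. -/
def tail (H : ℝ → ℂ) (r : ℝ) : ℝ := ∫ v in {v : ℝ | r < |v|}, ‖H v‖ ^ 2

theorem measurableSet_abs_gt (r : ℝ) : MeasurableSet {v : ℝ | r < |v|} :=
  measurableSet_lt measurable_const measurable_norm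

section Tail

variable {H : ℝ → ℂ} (hH : MemLp H 2 volume)
include hH

theorem tail_le (r : ℝ) : tail H r ≤ ∫ v, ‖H v‖ ^ 2 :=
  setIntegral_le_integral (integrable_norm_sq hH) (.of_forall fun _ ↦ by positivity)

/-- The energy in `r < |v| ≤ 2r`, with the negative half moved to `(r, 2r]` by the translation
`3r`. -/
theorem tail_sub_tail {r t : ℝ} (hr : 0 ≤ r) (ht : t = 3 * r) :
    tail H r - tail H (2 * r) =
      ∫ v in r..(2 * r), (‖H v‖ ^ 2 + ‖H (v - t)‖ ^ 2) := by
  have hrt : r ≤ 2 * r := by linarith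
  have hi := integrable_norm_sq hH
  have hi2 : Integrable fun v ↦ ‖H (v - t)‖ ^ 2 := hi.comp_sub_right t
  rw [intervalIntegral.integral_add hi.intervalIntegrable hi2.intervalIntegrable,
    intervalIntegral.integral_comp_sub_right (fun v ↦ ‖H v‖ ^ 2) t,
    show r - t = -(2 * r) by linarith, show 2 * r - t = -r by linarith,
    intervalIntegral.integral_of_le hrt, intervalIntegral.integral_of_le (by linarith),
    ← integral_Ico_eq_integral_Ioc (x := -(2 * r))]
  have hu : {v : ℝ | r < |v|} =
      {v : ℝ | 2 * r < |v|} ∪ (Set.Ioc r (2 * r) ∪ Set.Ico (-(2 * r)) (-r)) := by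
    ext v
    simp only [Set.mem_ofPred_eq, Set.mem_union, Set.mem_Ioc, Set.mem_Ico]
    rcases le_total 0 v with hv | hv
    · rw [abs_of_nonneg hv]; grind
    · rw [abs_of_nonpos hv]; grind
  rw [tail, hu, setIntegral_union _ (measurableSet_Ioc.union measurableSet_Ico) hi.integrableOn
    hi.integrableOn, setIntegral_union _ measurableSet_Ico hi.integrableOn hi.integrableOn, tail]
  · ring
  · rw [Set.disjoint_left]
    rintro v ⟨h1, h2⟩ ⟨h3, h4⟩
    linarith
  · rw [Set.disjoint_left]
    rintro v h1 (⟨h3, h4⟩ | ⟨h3, h4⟩)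
    · have h1 : 2 * r < |v| := h1
      rw [abs_of_nonneg (by linarith)] at h1
      linarith
    · have h1 : 2 * r < |v| := h1
      rw [abs_of_nonpos (by linarith)] at h1
      linarith

omit hH in
theorem tail_comp_mul (H : ℝ → ℂ) {c : ℝ} (hc : 0 < c) (r : ℝ) :
    c * tail (fun v ↦ H (c * v)) r = tail H (c * r) := by
  have h := Measure.integral_comp_mul_left
    ({v : ℝ | c * r < |v|}.indicator fun v ↦ ‖H v‖ ^ 2) c
  rw [integral_indicator (measurableSet_abs_gt _), abs_of_pos (inv_pos.2 hc), smul_eq_mul] at h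
  rw [tail, tail, ← integral_indicator (measurableSet_abs_gt _), ← mul_inv_cancel_left₀ hc.ne'
    (∫ v in {v : ℝ | c * r < |v|}, _), ← h]
  congr 2
  funext v
  simp [Set.indicator, abs_mul, abs_of_pos hc, hc]

theorem tendsto_tail_atTop : Tendsto (fun k : ℕ ↦ tail H (2 ^ k / 3)) atTop (𝓝 0) := by
  have hmono : Monotone fun k : ℕ ↦ (2 : ℝ) ^ k / 3 := fun i j hij ↦ by
    simp only
    gcongr
    norm_num
  have h := tendsto_setIntegral_of_antitone (μ := volume) (f := fun v ↦ ‖H v‖ ^ 2)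
    (s := fun k : ℕ ↦ {v : ℝ | (2 : ℝ) ^ k / 3 < |v|}) (fun k ↦ measurableSet_abs_gt _)
    (fun i j hij v hv ↦ (hmono hij).trans_lt hv) ⟨0, (integrable_norm_sq hH).integrableOn⟩
  have he : ⋂ k : ℕ, {v : ℝ | (2 : ℝ) ^ k / 3 < |v|} = ∅ := by
    rw [Set.eq_empty_iff_forall_notMem]
    intro v hv
    obtain ⟨k, hk⟩ := pow_unbounded_of_one_lt (3 * |v|) one_lt_two
    have : (2 : ℝ) ^ k / 3 < |v| := Set.mem_iInter.1 hv k
    linarith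
  rwa [he, setIntegral_empty] at h

theorem tendsto_tail_atBot :
    Tendsto (fun k : ℕ ↦ tail H (2 * ((2 ^ k)⁻¹ / 3))) atTop (𝓝 (∫ v, ‖H v‖ ^ 2)) := by
  have hmono : Antitone fun k : ℕ ↦ 2 * (((2 : ℝ) ^ k)⁻¹ / 3) := fun i j hij ↦ by
    simp only
    gcongr
    norm_num
  have h := tendsto_setIntegral_of_monotone (μ := volume) (f := fun v ↦ ‖H v‖ ^ 2)
    (s := fun k : ℕ ↦ {v : ℝ | 2 * (((2 : ℝ) ^ k)⁻¹ / 3) < |v|}) (fun k ↦ measurableSet_abs_gt _)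
    (fun i j hij v hv ↦ (hmono hij).trans_lt hv) (integrable_norm_sq hH).integrableOn
  have he : ⋃ k : ℕ, {v : ℝ | 2 * (((2 : ℝ) ^ k)⁻¹ / 3) < |v|} = {0}ᶜ := by
    ext v
    simp only [Set.mem_iUnion, Set.mem_ofPred_eq, Set.mem_compl_iff, Set.mem_singleton_iff]
    constructor
    · rintro ⟨k, hk⟩ rfl
      rw [abs_zero] at hk
      exact hk.not_ge (by positivity)
    · intro hv
      have hv : 0 < |v| := abs_pos.2 hv
      obtain ⟨k, hk⟩ := exists_pow_lt_of_lt_one hv (by norm_num : (2 : ℝ)⁻¹ < 1)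
      refine ⟨k, ?_⟩
      rw [inv_pow] at hk
      have : 0 < ((2 : ℝ) ^ k)⁻¹ := by positivity
      linarith
  rw [he, setIntegral_congr_set (t := Set.univ)] at h
  · simpa [tail] using h
  · exact ae_eq_univ.2 (by simp)

end Tail

/-- The squared modulus of one row of the rotation by `(α v, γ v)` applied to `(H v, H (v - 1))`. -/
def rot (α γ : ℝ → ℝ) (H : ℝ → ℂ) (v : ℝ) : ℝ := ‖α v * H v - γ v * H (v - 1)‖ ^ 2

/-- The energy of `H` beyond the scale one, with a gradual transition on `1 / 3 < |v| < 2 / 3`. -/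
def energy (α γ : ℝ → ℝ) (H : ℝ → ℂ) : ℝ :=
  (∫ v in (1 / 3 : ℝ)..(2 / 3), rot α γ H v) + tail H (2 / 3)

theorem norm_sq_rotation {a b : ℝ} (hab : a ^ 2 + b ^ 2 = 1) (x y : ℂ) :
    ‖b * x + a * y‖ ^ 2 = ‖x‖ ^ 2 + ‖y‖ ^ 2 - ‖a * x - b * y‖ ^ 2 := by
  simp only [← Complex.normSq_eq_norm_sq, Complex.normSq_apply, Complex.add_re, Complex.add_im,
    Complex.sub_re, Complex.sub_im, Complex.mul_re, Complex.mul_im, Complex.ofReal_re,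
    Complex.ofReal_im]
  linear_combination (x.re ^ 2 + x.im ^ 2 + y.re ^ 2 + y.im ^ 2) * hab

namespace ComplementaryPair

variable (h : ComplementaryPair α γ) {H : ℝ → ℂ} (hH : MemLp H 2 volume)
include h hH

theorem integrable_rot : Integrable (rot α γ H) :=
  integrable_norm_sq ((memLp_ofReal_mul hH h.continuous_left h.abs_left_le).sub
    (memLp_ofReal_mul (memLp_comp_sub hH 1) h.continuous_right h.abs_right_le))

theorem integrable_norm_sq_folded : Integrable fun v ↦ ‖folded α γ H v‖ ^ 2 := by
  have hβH := memLp_ofReal_mul hH h.continuous_band h.abs_band_le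
  exact integrable_norm_sq ((hβH.sub (memLp_comp_sub hβH 1)).add (memLp_comp_sub hβH 2))

/-- On `(1 / 3, 2 / 3)` the folded function is the row of the rotation that enters `energy H`; on
`(2 / 3, 4 / 3)` it is, after scaling by two, the complementary row to the one that enters the
energy of `H (2 ·)`. -/
theorem integral_norm_sq_folded :
    ∫ v in (1 / 3 : ℝ)..(4 / 3), ‖folded α γ H v‖ ^ 2 =
      energy α γ H - 2 * energy α γ fun v ↦ H (2 * v) := by
  have hQ := h.integrable_norm_sq_folded hH
  have hi := integrable_norm_sq hH
  have hi2 : Integrable fun v ↦ ‖H (v - 2)‖ ^ 2 := hi.comp_sub_right 2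
  set H2 : ℝ → ℂ := fun v ↦ H (2 * v) with hH2
  have hr2 := h.integrable_rot (memLp_comp_mul hH two_ne_zero)
  have e1 : ∫ v in (1 / 3 : ℝ)..(2 / 3), ‖folded α γ H v‖ ^ 2 =
      ∫ v in (1 / 3 : ℝ)..(2 / 3), rot α γ H v := by
    refine intervalIntegral.integral_congr fun v hv ↦ ?_
    rw [Set.uIcc_of_le (by norm_num)] at hv
    obtain ⟨b1, b2, b3⟩ := h.band_inner hv.1 hv.2
    simp [folded, rot, b1, b2, b3]
  have e2 : ∫ v in (2 / 3 : ℝ)..(4 / 3), ‖folded α γ H v‖ ^ 2 =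
      ∫ v in (2 / 3 : ℝ)..(4 / 3), ((‖H v‖ ^ 2 + ‖H (v - 2)‖ ^ 2) - rot α γ H2 (1 / 2 * v)) := by
    refine intervalIntegral.integral_congr fun v hv ↦ ?_
    rw [Set.uIcc_of_le (by norm_num)] at hv
    obtain ⟨b1, b2, b3⟩ := h.band_outer hv.1 hv.2
    simp only [folded, rot, b1, b2, b3, hH2]
    rw [Complex.ofReal_zero, zero_mul, sub_zero, norm_sq_rotation (h.sq_add_sq _)]
    ring_nf
  have e3 : ∫ v in (2 / 3 : ℝ)..(4 / 3), rot α γ H2 (1 / 2 * v) =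
      2 * ∫ v in (1 / 3 : ℝ)..(2 / 3), rot α γ H2 v := by
    rw [intervalIntegral.integral_comp_mul_left _ (by norm_num)]
    norm_num
  have e4 := tail_sub_tail hH (r := 2 / 3) (t := 2) (by norm_num) (by norm_num)
  rw [show (2 : ℝ) * (2 / 3) = 4 / 3 by norm_num] at e4
  have e5 := tail_comp_mul H two_pos (2 / 3)
  rw [show (2 : ℝ) * (2 / 3) = 4 / 3 by norm_num] at e5
  have e6 := intervalIntegral.integral_sub (hi.add hi2).intervalIntegrable
    (hr2.comp_mul_left' (R := 1 / 2) (by norm_num)).intervalIntegrable (a := 2 / 3) (b := 4 / 3)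
  simp only [Pi.add_apply] at e6
  rw [← intervalIntegral.integral_add_adjacent_intervals (b := 2 / 3) hQ.intervalIntegrable
    hQ.intervalIntegrable, e1, e2, e6, e3, ← e4, energy, energy, mul_add, e5]
  ring

omit h hH in
theorem tail_le_energy : tail H (2 / 3) ≤ energy α γ H :=
  le_add_of_nonneg_left (intervalIntegral.integral_nonneg (by norm_num) fun _ _ ↦ sq_nonneg _)

theorem energy_le_tail : energy α γ H ≤ tail H (1 / 3) := by
  have hi := integrable_norm_sq hH
  have hi1 : Integrable fun v ↦ ‖H (v - 1)‖ ^ 2 := hi.comp_sub_right 1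
  have e4 := tail_sub_tail hH (r := 1 / 3) (t := 1) (by norm_num) (by norm_num)
  rw [show (2 : ℝ) * (1 / 3) = 2 / 3 by norm_num] at e4
  have : ∫ v in (1 / 3 : ℝ)..(2 / 3), rot α γ H v ≤
      ∫ v in (1 / 3 : ℝ)..(2 / 3), (‖H v‖ ^ 2 + ‖H (v - 1)‖ ^ 2) := by
    refine intervalIntegral.integral_mono_on (by norm_num)
      (h.integrable_rot hH).intervalIntegrable (hi.add hi1).intervalIntegrable fun v _ ↦ ?_
    have := norm_sq_rotation (h.sq_add_sq v) (H v) (H (v - 1))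
    have h0 := sq_nonneg ‖γ v * H v + α v * H (v - 1)‖
    simp only [rot]
    linarith
  rw [energy]
  linarith

end ComplementaryPair

/-- The energy of `H` beyond the scale `2 ^ m`. -/
def energyAt (α γ : ℝ → ℝ) (H : ℝ → ℂ) (m : ℤ) : ℝ :=
  (2 : ℝ) ^ m * energy α γ fun v ↦ H (2 ^ m * v)

namespace ComplementaryPair

variable (h : ComplementaryPair α γ) {H : ℝ → ℂ} (hH : MemLp H 2 volume)

theorem tail_le_energyAt (m : ℤ) : tail H (2 * (2 ^ m / 3)) ≤ energyAt α γ H m := by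
  have := tail_comp_mul H (zpow_pos two_pos m : (0 : ℝ) < 2 ^ m) (2 / 3)
  rw [show (2 : ℝ) * (2 ^ m / 3) = 2 ^ m * (2 / 3) by ring, ← this, energyAt]
  exact mul_le_mul_of_nonneg_left tail_le_energy (zpow_pos two_pos m).le

include h hH

theorem energyAt_le_tail (m : ℤ) : energyAt α γ H m ≤ tail H (2 ^ m / 3) := by
  have := tail_comp_mul H (zpow_pos two_pos m : (0 : ℝ) < 2 ^ m) (1 / 3)
  rw [show (2 : ℝ) ^ m / 3 = 2 ^ m * (1 / 3) by ring, ← this, energyAt]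
  exact mul_le_mul_of_nonneg_left
    (h.energy_le_tail (memLp_comp_mul hH (zpow_pos two_pos m).ne')) (zpow_pos two_pos m).le

theorem integral_norm_sq_folded_zpow (m : ℤ) :
    (2 : ℝ) ^ m * ∫ v in (1 / 3 : ℝ)..(4 / 3), ‖folded α γ (fun w ↦ H (2 ^ m * w)) v‖ ^ 2 =
      energyAt α γ H m - energyAt α γ H (m + 1) := by
  rw [h.integral_norm_sq_folded (memLp_comp_mul hH (zpow_pos two_pos m).ne'), energyAt, energyAt,
    zpow_add_one₀ two_ne_zero, mul_sub]
  simp only [mul_assoc]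

theorem antitone_energyAt : Antitone (energyAt α γ H) :=
  antitone_int_of_succ_le fun m ↦ by
    have := h.integral_norm_sq_folded_zpow hH m
    have h2 : 0 ≤ (2 : ℝ) ^ m *
        ∫ v in (1 / 3 : ℝ)..(4 / 3), ‖folded α γ (fun w ↦ H (2 ^ m * w)) v‖ ^ 2 :=
      mul_nonneg (zpow_pos two_pos m).le
        (intervalIntegral.integral_nonneg (by norm_num) fun _ _ ↦ sq_nonneg _)
    linarith

/-- If the energy does not depend on the scale, its limits at the two ends agree, and these are `0`
and the full energy of `H`. -/
theorem integral_norm_sq_eq_zero (hc : ∀ m, energyAt α γ H (m + 1) = energyAt α γ H m) :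
    ∫ v, ‖H v‖ ^ 2 = 0 := by
  have hconst : ∀ m, energyAt α γ H m = energyAt α γ H 0 := fun m ↦ by
    induction m using Int.induction_on with
    | zero => rfl
    | succ i ih => rw [hc, ih]
    | pred i ih => rw [← hc, sub_add_cancel, ih]
  have h0 : energyAt α γ H 0 ≤ 0 := by
    refine ge_of_tendsto' (tendsto_tail_atTop hH) fun k ↦ ?_
    rw [← hconst k]
    exact_mod_cast h.energyAt_le_tail hH k
  refine le_antisymm (le_of_tendsto' (tendsto_tail_atBot hH) fun k ↦ ?_)
    (integral_nonneg fun _ ↦ sq_nonneg _)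
  rw [← hconst (-k)] at h0
  have := tail_le_energyAt (α := α) (γ := γ) (H := H) (-k : ℤ)
  rw [zpow_neg, zpow_natCast] at this
  exact this.trans h0

end ComplementaryPair

/-! ### Orthonormality and completeness on the frequency side -/

/-- The Fourier transform of the wavelet, for the kernel `exp (-2πixw)`. -/
def mother (α γ : ℝ → ℝ) (w : ℝ) : ℂ :=
  band α γ w * Complex.exp (-(Complex.I * Real.pi * w))

/-- The Fourier transform of `ψ_{m,n}`, for the kernel `exp (-2πixw)`. -/
def freqAtom (α γ : ℝ → ℝ) (m n : ℤ) (w : ℝ) : ℂ :=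
  ((((2 : ℝ) ^ ((m : ℝ) / 2))⁻¹ : ℝ) : ℂ) * (mother α γ (((2 : ℝ) ^ m)⁻¹ * w) *
    Complex.exp (-(2 * Complex.I * Real.pi * n * (((2 : ℝ) ^ m)⁻¹ * w : ℝ))))

theorem contDiff_mother {α γ : ℝ → ℝ} (hs : ContDiff ℝ ∞ (band α γ)) :
    ContDiff ℝ ∞ (mother α γ) :=
  (Complex.ofRealCLM.contDiff.comp hs).mul
    (Complex.contDiff_exp.comp (contDiff_const.mul Complex.ofRealCLM.contDiff).neg)

theorem ComplementaryPair.hasCompactSupport_mother {α γ : ℝ → ℝ} (h : ComplementaryPair α γ) :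
    HasCompactSupport (mother α γ) :=
  (h.hasCompactSupport_band.comp_left (g := ((↑) : ℝ → ℂ)) Complex.ofReal_zero).mul_right

theorem rpow_half_sq (m : ℤ) : ((2 : ℝ) ^ ((m : ℝ) / 2)) ^ 2 = 2 ^ m := by
  rw [← Real.rpow_natCast, ← Real.rpow_mul two_pos.le, ← Real.rpow_intCast]
  norm_num

theorem freqAtom_mul (m n : ℤ) (v : ℝ) : freqAtom α γ m n (2 ^ m * v) =
    ((((2 : ℝ) ^ ((m : ℝ) / 2))⁻¹ : ℝ) : ℂ) *
      (band α γ v * Complex.exp (-(Complex.I * Real.pi * (2 * n + 1) * v))) := by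
  rw [freqAtom, mother, inv_mul_cancel_left₀ (zpow_pos two_pos m).ne', mul_assoc (band α γ v : ℂ),
    ← Complex.exp_add]
  ring_nf

namespace ComplementaryPair

variable (h : ComplementaryPair α γ)
include h

theorem integral_band_sq : ∫ v, band α γ v ^ 2 = 1 := by
  have hi : Integrable fun v ↦ band α γ v ^ 2 := by
    simpa only [sq] using! (h.continuous_band.mul h.continuous_band).integrable_of_hasCompactSupport
      h.hasCompactSupport_band.mul_right
  have e : ∫ v in (1 / 3 : ℝ)..(4 / 3),
      (band α γ v ^ 2 + band α γ (v - 1) ^ 2 + band α γ (v - 2) ^ 2) =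
      ∫ _ in (1 / 3 : ℝ)..(4 / 3), 1 := by
    refine intervalIntegral.integral_congr fun v hv ↦ ?_
    rw [Set.uIcc_of_le (by norm_num)] at hv
    rcases le_total v (2 / 3) with h1 | h1
    · obtain ⟨b1, b2, b3⟩ := h.band_inner hv.1 h1
      simp only [b1, b2, b3]
      linear_combination h.sq_add_sq v
    · obtain ⟨b1, b2, b3⟩ := h.band_outer h1 hv.2
      simp only [b1, b2, b3]
      linear_combination h.sq_add_sq (v / 2)
  rw [integral_eq_periodized hi fun v hv ↦ by simp [h.band_eq_zero_of_ge hv], e]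
  norm_num

theorem integral_norm_sq_freqAtom (m n : ℤ) : ∫ w, ‖freqAtom α γ m n w‖ ^ 2 = 1 := by
  have hc : (0 : ℝ) < 2 ^ m := zpow_pos two_pos m
  have e := Measure.integral_comp_mul_left (fun w ↦ ‖freqAtom α γ m n w‖ ^ 2) (2 ^ m)
  have e2 : ∀ v : ℝ, ‖freqAtom α γ m n (2 ^ m * v)‖ ^ 2 = (2 ^ m)⁻¹ * band α γ v ^ 2 := by
    intro v
    have hn : ‖Complex.exp (-(Complex.I * Real.pi * (2 * n + 1) * v))‖ = 1 := by
      rw [show -(Complex.I * Real.pi * (2 * n + 1) * v) =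
        ((-(Real.pi * (2 * n + 1) * v) : ℝ) : ℂ) * Complex.I by push_cast; ring]
      exact Complex.norm_exp_ofReal_mul_I _
    rw [freqAtom_mul, norm_mul, norm_mul, hn, Complex.norm_real, Complex.norm_real, mul_one,
      mul_pow, norm_inv, inv_pow, Real.norm_eq_abs, Real.norm_eq_abs, sq_abs, sq_abs,
      rpow_half_sq]
  simp only [e2] at e
  rw [integral_const_mul, h.integral_band_sq, abs_of_pos (inv_pos.2 hc), smul_eq_mul] at e
  exact (mul_left_cancel₀ (inv_pos.2 hc).ne' e).symm

theorem hasSum_norm_sq_integral_freqAtom {H : ℝ → ℂ} (hH : MemLp H 2 volume) (m : ℤ) :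
    HasSum (fun n : ℤ ↦ ‖∫ w, H w * (starRingEnd ℂ) (freqAtom α γ m n w)‖ ^ 2)
      (energyAt α γ H m - energyAt α γ H (m + 1)) := by
  have hc : (0 : ℝ) < 2 ^ m := zpow_pos two_pos m
  rw [← h.integral_norm_sq_folded_zpow hH]
  refine ((hasSum_norm_sq_integral_band h (memLp_comp_mul hH hc.ne')).mul_left _).congr_fun
    fun n ↦ ?_
  have e := Measure.integral_comp_mul_left
    (fun w ↦ H w * (starRingEnd ℂ) (freqAtom α γ m n w)) (2 ^ m)
  have e2 : ∀ v : ℝ, H (2 ^ m * v) * (starRingEnd ℂ) (freqAtom α γ m n (2 ^ m * v)) =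
      ((((2 : ℝ) ^ ((m : ℝ) / 2))⁻¹ : ℝ) : ℂ) * (band α γ v * H (2 ^ m * v) *
        Complex.exp (Complex.I * Real.pi * (2 * n + 1) * v)) := by
    intro v
    rw [freqAtom_mul, map_mul, map_mul, Complex.conj_ofReal, Complex.conj_ofReal,
      ← Complex.exp_conj]
    simp only [map_neg, map_mul, map_add, Complex.conj_I, Complex.conj_ofReal, map_ofNat, map_one,
      map_intCast]
    ring_nf
  simp only [e2] at e
  rw [integral_const_mul, abs_of_pos (inv_pos.2 hc)] at e
  have e3 : ∫ w, H w * (starRingEnd ℂ) (freqAtom α γ m n w) = (2 : ℝ) ^ m •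
      (((((2 : ℝ) ^ ((m : ℝ) / 2))⁻¹ : ℝ) : ℂ) * ∫ v, band α γ v * H (2 ^ m * v) *
        Complex.exp (Complex.I * Real.pi * (2 * n + 1) * v)) := by
    rw [e, smul_inv_smul₀ hc.ne']
  rw [e3, norm_smul, norm_mul, Complex.norm_real, norm_inv, mul_pow, mul_pow, inv_pow,
    Real.norm_eq_abs, Real.norm_eq_abs, sq_abs, sq_abs, rpow_half_sq]
  field_simp

end ComplementaryPair

theorem norm_sq_eq_integral (f : Lp ℂ 2 (volume : Measure ℝ)) : ‖f‖ ^ 2 = ∫ x, ‖f x‖ ^ 2 := by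
  have h1 := inner_self_eq_norm_sq_to_K (𝕜 := ℂ) f
  rw [L2.inner_def] at h1
  simp only [inner_self_eq_norm_sq_to_K] at h1
  have : ∀ x, ((‖f x‖ : ℂ)) ^ 2 = ((‖f x‖ ^ 2 : ℝ) : ℂ) := fun x ↦ by push_cast; rfl
  simp only [Complex.coe_algebraMap, this] at h1
  rw [integral_complex_ofReal] at h1
  exact_mod_cast h1.symm

section Basis

variable (h : ComplementaryPair α γ) {e : ℤ × ℤ → Lp ℂ 2 (volume : Measure ℝ)}
  (he : ∀ m n, e (m, n) =ᵐ[volume] freqAtom α γ m n)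
include h he

theorem ComplementaryPair.hasSum_norm_sq_inner (f : Lp ℂ 2 (volume : Measure ℝ)) (m : ℤ) :
    HasSum (fun n : ℤ ↦ ‖inner ℂ (e (m, n)) f‖ ^ 2)
      (energyAt α γ f m - energyAt α γ f (m + 1)) := by
  convert h.hasSum_norm_sq_integral_freqAtom (Lp.memLp f) m using 2 with n
  rw [L2.inner_def]
  congr 2
  refine integral_congr_ae ?_
  filter_upwards [he m n] with x hx
  rw [hx, RCLike.inner_apply]

theorem ComplementaryPair.norm_eq_one (i : ℤ × ℤ) : ‖e i‖ = 1 := by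
  have h1 : ‖e i‖ ^ 2 = 1 := by
    rw [norm_sq_eq_integral, ← h.integral_norm_sq_freqAtom i.1 i.2]
    refine integral_congr_ae ?_
    filter_upwards [he i.1 i.2] with x hx
    rw [hx]
  exact (pow_eq_one_iff_of_nonneg (norm_nonneg _) two_ne_zero).1 h1

/-- Bessel's inequality for two atoms: their coefficients are bounded by one or two differences of
the decreasing sequence of energies, which takes values in `[0, ‖f‖²]`. -/
theorem ComplementaryPair.norm_sq_inner_add_le (f : Lp ℂ 2 (volume : Measure ℝ)) {i j : ℤ × ℤ}
    (hij : i ≠ j) : ‖inner ℂ (e i) f‖ ^ 2 + ‖inner ℂ (e j) f‖ ^ 2 ≤ ‖f‖ ^ 2 := by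
  obtain ⟨m, n⟩ := i
  obtain ⟨m', n'⟩ := j
  have hf := Lp.memLp f
  have hanti := h.antitone_energyAt hf
  have h0 : ∀ m, 0 ≤ energyAt α γ f m := fun m ↦
    (setIntegral_nonneg (measurableSet_abs_gt _) fun _ _ ↦ sq_nonneg _).trans
      (ComplementaryPair.tail_le_energyAt m)
  have h1 : ∀ m, energyAt α γ f m ≤ ‖f‖ ^ 2 := fun m ↦ by
    rw [norm_sq_eq_integral]
    exact (h.energyAt_le_tail hf m).trans (tail_le hf _)
  have hS := h.hasSum_norm_sq_inner he f
  by_cases hm : m = m'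
  · subst hm
    have hn : n ≠ n' := fun hn ↦ hij (by rw [hn])
    have := sum_le_hasSum {n, n'} (fun _ _ ↦ sq_nonneg _) (hS m)
    rw [Finset.sum_pair hn] at this
    linarith [h1 m, h0 (m + 1)]
  · have a1 := le_hasSum (hS m) n fun _ _ ↦ sq_nonneg _
    have a2 := le_hasSum (hS m') n' fun _ _ ↦ sq_nonneg _
    rcases lt_or_gt_of_ne hm with hlt | hlt
    · have := hanti (show m + 1 ≤ m' by omega)
      linarith [h1 m, h0 (m' + 1)]
    · have := hanti (show m' + 1 ≤ m by omega)
      linarith [h1 m', h0 (m + 1)]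

theorem ComplementaryPair.orthonormal : Orthonormal ℂ e := by
  refine ⟨h.norm_eq_one he, fun i j hij ↦ ?_⟩
  have h1 := h.norm_sq_inner_add_le he (e j) hij
  rw [inner_self_eq_norm_sq_to_K, h.norm_eq_one he] at h1
  have h2 : ‖inner ℂ (e i) (e j)‖ ^ 2 ≤ 0 := by simpa using h1
  exact norm_eq_zero.1 (pow_eq_zero_iff two_ne_zero |>.1 (le_antisymm h2 (sq_nonneg _)))

theorem ComplementaryPair.orthogonal_span_eq_bot :
    (Submodule.span ℂ (Set.range e))ᗮ = ⊥ := by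
  rw [Submodule.eq_bot_iff]
  intro f hf
  have h0 : ∀ i, inner ℂ (e i) f = 0 := fun i ↦
    (Submodule.mem_orthogonal _ f).1 hf _ (Submodule.subset_span ⟨i, rfl⟩)
  have h1 : ‖f‖ ^ 2 = 0 := by
    rw [norm_sq_eq_integral]
    refine h.integral_norm_sq_eq_zero (Lp.memLp f) fun m ↦ ?_
    have := h.hasSum_norm_sq_inner he f m
    simp only [h0, norm_zero, ne_eq, OfNat.ofNat_ne_zero, not_false_eq_true, zero_pow] at this
    linarith [this.unique hasSum_zero]
  exact norm_eq_zero.1 (pow_eq_zero_iff two_ne_zero |>.1 h1)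

end Basis

/-! ### The wavelet -/

theorem IsCutoff.complementaryPair {k : Kind} {σ a : ℝ} {φ : ℝ → ℝ} (hσ : 1 < σ)
    (ha' : a < Real.pi / 3) (h : IsCutoff k σ a φ) :
    ComplementaryPair (fun v ↦ Real.sin (primitive φ (2 * Real.pi * |v| - Real.pi)))
      (fun v ↦ Real.cos (primitive φ (2 * Real.pi * |v| - Real.pi))) := by
  have hc : Continuous (primitive φ) :=
    continuous_iff_continuousAt.2 fun x ↦ (h.hasDerivAt_primitive hσ x).continuousAt
  have hπ := Real.pi_pos
  -- The transition zone `|2π|v| - π| ≤ a` lies in `1 / 3 < |v| < 2 / 3` because `a < π / 3`.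
  have hlow : ∀ v : ℝ, |v| ≤ 1 / 3 → primitive φ (2 * Real.pi * |v| - Real.pi) = 0 :=
    fun v hv ↦ h.primitive_eq_zero (by nlinarith)
  have hhigh : ∀ v : ℝ, 2 / 3 ≤ |v| →
      primitive φ (2 * Real.pi * |v| - Real.pi) = Real.pi / 2 :=
    fun v hv ↦ h.primitive_eq_pi_div_two hσ (by nlinarith)
  refine ⟨by fun_prop, by fun_prop, fun v ↦ Real.sin_sq_add_cos_sq _, fun v hv ↦ ?_, fun v hv ↦ ?_,
    fun v hv ↦ ?_, fun v hv ↦ ?_, fun v ↦ by rw [abs_neg], fun v ↦ by rw [abs_neg],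
    fun v h0 h1 ↦ ?_⟩
  · rw [hlow v hv, Real.sin_zero]
  · rw [hlow v hv, Real.cos_zero]
  · rw [hhigh v hv, Real.sin_pi_div_two]
  · rw [hhigh v hv, Real.cos_pi_div_two]
  · have := h.primitive_add_primitive_neg hσ (2 * Real.pi * v - Real.pi)
    rw [abs_of_nonneg h0, abs_of_nonneg (by linarith), ← Real.sin_pi_div_two_sub, ← this]
    ring_nf

theorem band_eq_bell (φ : ℝ → ℝ) (v : ℝ) :
    band (fun v ↦ Real.sin (primitive φ (2 * Real.pi * |v| - Real.pi)))
      (fun v ↦ Real.cos (primitive φ (2 * Real.pi * |v| - Real.pi))) v =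
      bell φ (2 * Real.pi * v) := by
  rw [bell_eq, band, abs_mul, abs_of_pos Real.two_pi_pos, abs_div, abs_two]
  ring_nf

/-- Transport of the orthonormal basis of frequency atoms by the inverse Fourier transform of `L²`,
which on these Schwartz functions is given by the Fourier integral. -/
theorem isOrthonormalWavelet_fourierInv {α γ : ℝ → ℝ} (h : ComplementaryPair α γ)
    (hs : ContDiff ℝ ∞ (band α γ)) (Ψ : 𝓢(ℝ, ℂ)) (hΨ : ∀ w, Ψ w = mother α γ w) :
    IsOrthonormalWavelet (𝓕⁻ Ψ : 𝓢(ℝ, ℂ)) := by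
  have hms := contDiff_mother hs
  have hmc := h.hasCompactSupport_mother
  have has : ∀ m n, ContDiff ℝ ∞ (freqAtom α γ m n) := fun m n ↦ by
    refine contDiff_const.mul ((hms.comp (contDiff_const.mul contDiff_id)).mul
      (Complex.contDiff_exp.comp (ContDiff.neg (contDiff_const.mul
        (Complex.ofRealCLM.contDiff.comp (contDiff_const.mul contDiff_id))))))
  have hac : ∀ m n, HasCompactSupport (freqAtom α γ m n) := fun m n ↦ by
    have := hmc.comp_smul (inv_ne_zero (zpow_pos (two_pos (α := ℝ)) m).ne')
    simp only [smul_eq_mul] at this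
    exact (this.mul_right (f' := fun w : ℝ ↦
      Complex.exp (-(2 * Complex.I * Real.pi * n * (((2 : ℝ) ^ m)⁻¹ * w : ℝ))))).mul_left
  set S : ℤ × ℤ → 𝓢(ℝ, ℂ) := fun i ↦ (hac i.1 i.2).toSchwartzMap (has i.1 i.2) with hS
  set e : ℤ × ℤ → Lp ℂ 2 (volume : Measure ℝ) := fun i ↦ (S i).toLp 2 with he
  have hae : ∀ m n, e (m, n) =ᵐ[volume] freqAtom α γ m n := fun m n ↦
    (S (m, n)).coeFn_toLp 2 volume
  set b₀ := HilbertBasis.mkOfOrthogonalEqBot (h.orthonormal hae) (h.orthogonal_span_eq_bot hae)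
    with hb₀
  refine ⟨SchwartzMap.memLp _ 2 volume,
    .ofRepr ((Lp.fourierTransformₗᵢ ℝ ℂ).trans b₀.repr), fun m n ↦ ?_⟩
  have hb : (HilbertBasis.ofRepr ((Lp.fourierTransformₗᵢ ℝ ℂ).trans b₀.repr)) (m, n) =
      (𝓕⁻ (S (m, n))).toLp 2 := by
    rw [← SchwartzMap.toLp_fourierInv_eq]
    change (Lp.fourierTransformₗᵢ ℝ ℂ).symm (b₀ (m, n)) = _
    rw [hb₀, HilbertBasis.coe_mkOfOrthogonalEqBot]
    rfl
  rw [hb]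
  refine ((𝓕⁻ (S (m, n))).coeFn_toLp 2 volume).trans (.of_forall fun x ↦ ?_)
  have hc : (0 : ℝ) < 2 ^ m := zpow_pos two_pos m
  rw [atom, SchwartzMap.fourierInv_coe, SchwartzMap.fourierInv_coe, Real.fourierInv_eq',
    Real.fourierInv_eq']
  have key := Measure.integral_comp_mul_left (fun v : ℝ ↦
    ((((2 : ℝ) ^ ((m : ℝ) / 2))⁻¹ : ℝ) : ℂ) *
      (Complex.exp (2 * Real.pi * (v * (2 ^ m * x - n) : ℝ) * Complex.I) * mother α γ v))
    ((2 : ℝ) ^ m)⁻¹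
  rw [inv_inv, abs_of_pos hc] at key
  have e1 : ∫ v, Complex.exp (((2 * Real.pi * inner ℝ v x : ℝ) : ℂ) * Complex.I) • S (m, n) v =
      ∫ w : ℝ, ((((2 : ℝ) ^ ((m : ℝ) / 2))⁻¹ : ℝ) : ℂ) *
      (Complex.exp (2 * Real.pi * ((2 ^ m)⁻¹ * w * (2 ^ m * x - n) : ℝ) * Complex.I) *
        mother α γ ((2 ^ m)⁻¹ * w)) := by
    refine integral_congr_ae (.of_forall fun w ↦ ?_)
    simp only [hS, HasCompactSupport.toSchwartzMap_toFun, freqAtom, smul_eq_mul, RCLike.inner_apply,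
      conj_trivial]
    have : Complex.exp (2 * Real.pi * ((2 ^ m)⁻¹ * w * (2 ^ m * x - n) : ℝ) * Complex.I) =
        Complex.exp (((2 * Real.pi * (x * w) : ℝ) : ℂ) * Complex.I) *
        Complex.exp (-(2 * Complex.I * Real.pi * n * (((2 : ℝ) ^ m)⁻¹ * w : ℝ))) := by
      rw [← Complex.exp_add]
      congr 1
      have : ((2 : ℂ) ^ m) ≠ 0 := zpow_ne_zero m two_ne_zero
      push_cast
      field_simp
      ring
    rw [this]
    ring
  rw [e1, key, integral_const_mul, Complex.real_smul, ← mul_assoc, ← Complex.ofReal_mul]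
  congr 1
  · rw [← rpow_half_sq m]
    congr 1
    have : (2 : ℝ) ^ ((m : ℝ) / 2) ≠ 0 := by positivity
    field_simp
  · refine integral_congr_ae (.of_forall fun w ↦ ?_)
    simp only [hΨ, smul_eq_mul, RCLike.inner_apply, conj_trivial]
    push_cast
    ring_nf

/-- Comparison of the kernels `exp (ixξ)` and `exp (-2πixw)`, with `w = -ξ / 2π`. -/
theorem fourierHat_fourierInv (Ψ : 𝓢(ℝ, ℂ)) (ξ : ℝ) :
    fourierHat (𝓕⁻ Ψ : 𝓢(ℝ, ℂ)) ξ = Ψ (-ξ / (2 * Real.pi)) := by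
  have h : (𝓕 (𝓕⁻ Ψ : 𝓢(ℝ, ℂ)) : 𝓢(ℝ, ℂ)) = Ψ := FourierTransform.fourier_fourierInv_eq Ψ
  conv_rhs => rw [← h]
  rw [SchwartzMap.fourier_coe, Real.fourier_eq', fourierHat]
  refine integral_congr_ae (.of_forall fun x ↦ ?_)
  simp only [smul_eq_mul, RCLike.inner_apply, conj_trivial]
  rw [mul_comm]
  congr 2
  have := Real.pi_ne_zero
  push_cast
  field_simp

end

end ExtGevrey

open ExtGevrey in
theorem lemma3p2 (k : ExtGevrey.Kind) (σ : ℝ) (hσ : 1 < σ)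
    (a : ℝ) (ha : 0 < a) (ha' : a < Real.pi / 3) :
    (∃ φ : ℝ → ℝ, ExtGevrey.IsCutoff k σ a φ) ∧
    ∀ φ : ℝ → ℝ, ExtGevrey.IsCutoff k σ a φ →
      ∃ ψ : ℝ → ℂ,
        ContDiff ℝ (⊤ : ℕ∞) ψ ∧
        ExtGevrey.IsOrthonormalWavelet ψ ∧
        MeasureTheory.Integrable ψ ∧
        (∀ ξ : ℝ, ExtGevrey.fourierHat ψ ξ =
          Complex.exp (Complex.I * (ξ : ℂ) / 2) * (ExtGevrey.bell φ ξ : ℂ)) ∧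
        ExtGevrey.fourierHat ψ ∈ ExtGevrey.DInter k σ ℂ := by
  refine ⟨exists_isCutoff k hσ ha, fun φ hφ ↦ ?_⟩
  have hπ := Real.pi_pos
  have hpair := hφ.complementaryPair hσ ha'
  have hbell := hφ.ultraSmooth_bell hσ (by linarith)
  set α : ℝ → ℝ := fun v ↦ Real.sin (primitive φ (2 * Real.pi * |v| - Real.pi))
  set γ : ℝ → ℝ := fun v ↦ Real.cos (primitive φ (2 * Real.pi * |v| - Real.pi))
  have hband : ∀ v, band α γ v = bell φ (2 * Real.pi * v) := band_eq_bell φ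
  have hs : ContDiff ℝ (⊤ : ℕ∞) (band α γ) := by
    rw [funext hband]
    exact hbell.contDiff.comp (contDiff_const.mul contDiff_id)
  have hms := contDiff_mother hs
  have hmc := hpair.hasCompactSupport_mother
  set Ψ := hmc.toSchwartzMap hms
  have hΨ : ∀ w, Ψ w = mother α γ w := fun w ↦ rfl
  have hhat : ∀ ξ : ℝ, fourierHat (FourierTransformInv.fourierInv Ψ : SchwartzMap ℝ ℂ) ξ =
      Complex.exp (Complex.I * (ξ : ℂ) / 2) * (bell φ ξ : ℂ) := by
    intro ξ
    rw [fourierHat_fourierInv, hΨ, mother, hband, mul_div_cancel₀ _ Real.two_pi_pos.ne', mul_comm]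
    congr 2
    · have := Real.pi_ne_zero
      push_cast
      field_simp
    · simp [bell]
  refine ⟨(FourierTransformInv.fourierInv Ψ : SchwartzMap ℝ ℂ), SchwartzMap.smooth _ ⊤,
    isOrthonormalWavelet_fourierInv hpair hs Ψ hΨ, SchwartzMap.integrable _, hhat, ?_⟩
  have hcs : HasCompactSupport (bell φ) :=
    .intro (K := Set.Icc (-(2 * (Real.pi + a))) (2 * (Real.pi + a))) isCompact_Icc
      fun ξ hξ ↦ hφ.bell_eq_zero hσ <| by
        by_contra! h'
        exact hξ (abs_le.1 h'.le)
  have hU := (UltraSmooth.cexp_I_mul (1 / 2) hσ).mul hσ hbell.ofReal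
  rw [funext hhat]
  have e : (fun ξ : ℝ ↦ Complex.exp (Complex.I * (ξ : ℂ) / 2) * (bell φ ξ : ℂ)) =
      fun ξ : ℝ ↦ Complex.exp (Complex.I * ξ * ((1 / 2 : ℝ) : ℂ)) * (bell φ ξ : ℂ) := by
    funext ξ
    push_cast
    ring_nf
  rw [e]
  exact hU.mem_DInter hσ
    ((hcs.comp_left (g := ((↑) : ℝ → ℂ)) Complex.ofReal_zero).mul_left) k
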